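/- A Halin graph $H=T\cup C$ is a finite planar graph that is the union of a tree $T$ without nodes of degree two and a cycle $C$ (of length at least $3$) whose nodes are exactly the leaves of $T$. A planar embedding of $H$ represents the nodes by distinct points of the plane and each edge by a simple arc joining its two end nodes, such that an edge contains no node other than its ends and two distinct edges meet only in common end nodes; its faces are the connected components of the complement of the embedded graph in the plane (including the unbounded one), and a face contains an edge if the edge lies on the boundary of the face. Two distinct edges $(u,x)$ and $(x,v)$ of $H$ are called consecutive at $x$ in the embedding if there is a face that contains both of them, and non-consecutive at $x$ otherwise. Theorem. Let $H=T\cup C$ be a Halin graph and fix any planar embedding of $H$. Then no Hamilton cycle of $H$ contains two distinct edges $(u,x)$ and $(x,v)$ that are non-consecutive at $x$. -/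

import Mathlib

/-- `A` is an arc in the plane with end points `a` and `b`: the image of an injective path. -/
def IsPlaneArc (A : Set ℂ) (a b : ℂ) : Prop :=
  ∃ γ : Path a b, Function.Injective γ ∧ Set.range γ = A

/-- An embedding of the graph `G` in the plane (the topological space `ℂ`): nodes are distinct
points, edges are arcs joining their end nodes, an edge passes through no node other than its two
ends, and two distinct edges meet only in common end nodes.
(The value of `arc` at a pair that is not an edge of `G` is irrelevant.) -/
structure PlanarEmbedding {V : Type*} (G : SimpleGraph V) where
  point : V → ℂ
  arc : Sym2 V → Set ℂ
  point_injective : Function.Injective point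
  isPlaneArc : ∀ u v : V, G.Adj u v → IsPlaneArc (arc s(u, v)) (point u) (point v)
  mem_of_point_mem_arc : ∀ e ∈ G.edgeSet, ∀ w : V, point w ∈ arc e → w ∈ e
  arc_inter : ∀ e ∈ G.edgeSet, ∀ f ∈ G.edgeSet, e ≠ f →
    ∀ z ∈ arc e ∩ arc f, ∃ w : V, w ∈ e ∧ w ∈ f ∧ z = point w

namespace PlanarEmbedding

/-- The point set of the embedded graph. -/
def support {V : Type*} {G : SimpleGraph V} (E : PlanarEmbedding G) : Set ℂ :=
  Set.range E.point ∪ ⋃ e ∈ G.edgeSet, E.arc e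

/-- The faces (including the unbounded one) are the connected components of the complement of the
embedded graph. -/
def IsFace {V : Type*} {G : SimpleGraph V} (E : PlanarEmbedding G) (F : Set ℂ) : Prop :=
  ∃ z ∈ E.supportᶜ, F = connectedComponentIn E.supportᶜ z

/-- The edges `(u, x)` and `(x, v)` are consecutive at `x` if some face contains both of them, that
is, has both of them on its boundary. -/
def ConsecutiveAt {V : Type*} {G : SimpleGraph V} (E : PlanarEmbedding G) (u x v : V) : Prop :=
  ∃ F : Set ℂ, E.IsFace F ∧ E.arc s(u, x) ⊆ frontier F ∧ E.arc s(x, v) ⊆ frontier F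

end PlanarEmbedding

/-- `T ⊔ C` is a Halin graph with underlying tree `T` and outer cycle `C`: `T` is a tree on all the
nodes without nodes of degree two, the edges of `C` are those of a cycle whose nodes are exactly the
leaves of `T`, and the union is planar. -/
structure IsHalin {V : Type*} [Fintype V] (T C : SimpleGraph V) [DecidableRel T.Adj] : Prop where
  isTree : T.IsTree
  degree_ne_two : ∀ v : V, T.degree v ≠ 2
  outer_cycle : ∃ (r : V) (c : C.Walk r r), c.IsCycle ∧
    (∀ v : V, v ∈ c.support ↔ T.degree v = 1) ∧ ∀ e : Sym2 V, e ∈ c.edges ↔ e ∈ C.edgeSet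
  planar : Nonempty (PlanarEmbedding (T ⊔ C))

/-! Let `x` be a node and let the Hamilton cycle `τ` use `xu` and `xv`. The faces needed come from
one principle (`exists_isFace_of_isCycle`): a cycle without chords whose removal leaves the graph
connected bounds a face. It applies to the outer cycle and to every cycle formed by an outer edge
`ab` and the tree path from `a` to `b`. This settles the case of a leaf `x`, where at least one of
the two edges is an outer edge.

If `x` is an inner node, both edges are tree edges, and the components of `T - x` (branches)
correspond to the tree neighbours of `x`. It suffices to find an outer edge `lm` between the
branches of `u` and `v`: the tree path from `l` to `m` then runs through `xu` and `xv`, and these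
lie on one face. A closed walk crosses the boundary of a branch an even number of times, and the
only tree edge that crosses it is the one at `x`. Since `τ` uses `xu`, parity shows that some outer
edge `lm` leaving the branch of `u` is not in `τ`. Suppose that `m` lies in the branch of a third
neighbour `w`. Then `τ` does not use `xw`, and the outer cycle crosses that branch at most twice
(`crossings_branch_le_two`), once by `lm`. So `τ` crosses at most once, hence never, and cannot
visit both `x` and `w`.

Planarity enters through Janiszewski's theorem, obtained from Eilenberg's criterion: a compact set
fails to separate `p` from `q` exactly when `(z - p) / (z - q)` has a continuous logarithm on it. It
shows that an edge of a cycle lies on the boundary of every component of the complement of the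
cycle, and (`not_alternating`) that the leaves of a branch do not alternate with other leaves along
the outer cycle. -/

open Set Filter Topology SimpleGraph

/-! ### Separation in the plane by continuous logarithms -/

/-- The points `p` and `q` lie in a common connected part of the complement of `K`. -/
def NotSeparated (K : Set ℂ) (p q : ℂ) : Prop :=
  ∃ t : Set ℂ, IsPreconnected t ∧ t ⊆ Kᶜ ∧ p ∈ t ∧ q ∈ t

/-- The function `z ↦ (z - p) / (z - q)` has a continuous logarithm on `K`. -/
def HasRatioLog (K : Set ℂ) (p q : ℂ) : Prop :=
  ∃ g : ℂ → ℂ, ContinuousOn g K ∧ ∀ z ∈ K, Complex.exp (g z) = (z - p) / (z - q)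

theorem NotSeparated.left_notMem {K : Set ℂ} {p q : ℂ} (h : NotSeparated K p q) : p ∉ K := by
  obtain ⟨t, -, ht, hp, -⟩ := h; exact ht hp

theorem NotSeparated.right_notMem {K : Set ℂ} {p q : ℂ} (h : NotSeparated K p q) : q ∉ K := by
  obtain ⟨t, -, ht, -, hq⟩ := h; exact ht hq

/-- The ratio is `1 + (q - p) / (z - q)`, which stays in the open unit disc around `1`, where the
principal logarithm is continuous. -/
theorem hasRatioLog_of_dist_lt {K : Set ℂ} {p q : ℂ} (h : ∀ z ∈ K, ‖q - p‖ < ‖z - q‖) :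
    HasRatioLog K p q := by
  have hne : ∀ z ∈ K, z - q ≠ 0 := fun z hz h0 ↦ by
    have := h z hz
    rw [h0, norm_zero] at this
    exact absurd this (not_lt.2 (norm_nonneg _))
  have hsp : ∀ z ∈ K, (z - p) / (z - q) ∈ Complex.slitPlane := fun z hz ↦ by
    have h1 : (z - p) / (z - q) = 1 + (q - p) / (z - q) := by
      field_simp [hne z hz]; ring
    rw [h1]
    apply Complex.mem_slitPlane_of_norm_lt_one
    rw [norm_div, div_lt_one (norm_pos_iff.2 (hne z hz))]
    exact h z hz
  refine ⟨fun z ↦ Complex.log ((z - p) / (z - q)), ?_, fun z hz ↦ ?_⟩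
  · refine ContinuousOn.clog ?_ hsp
    exact ContinuousOn.div (by fun_prop) (by fun_prop) hne
  · exact Complex.exp_log (Complex.slitPlane_ne_zero (hsp z hz))

theorem HasRatioLog.symm {K : Set ℂ} {p q : ℂ} (h : HasRatioLog K p q) : HasRatioLog K q p := by
  obtain ⟨g, hg, he⟩ := h
  refine ⟨fun z ↦ -g z, hg.neg, fun z hz ↦ ?_⟩
  rw [Complex.exp_neg, he z hz, inv_div]

theorem HasRatioLog.trans {K : Set ℂ} {p q r : ℂ} (hq : q ∉ K) (h : HasRatioLog K p q)
    (h' : HasRatioLog K q r) : HasRatioLog K p r := by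
  obtain ⟨g, hg, he⟩ := h
  obtain ⟨g', hg', he'⟩ := h'
  refine ⟨fun z ↦ g z + g' z, hg.add hg', fun z hz ↦ ?_⟩
  have : z - q ≠ 0 := fun h0 ↦ hq (by rwa [← sub_eq_zero.1 h0])
  rw [Complex.exp_add, he z hz, he' z hz, div_mul_div_cancel₀ this]

/-- Points that are not separated by a closed set have a ratio logarithm on it. -/
theorem NotSeparated.hasRatioLog {K : Set ℂ} (hK : IsClosed K) {p q : ℂ}
    (h : NotSeparated K p q) : HasRatioLog K p q := by
  obtain ⟨t, ht, htK, hp, hq⟩ := h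
  refine ht.induction₂' (fun p q ↦ HasRatioLog K p q) (fun x hx ↦ ?_) ?_ hp hq
  · obtain ⟨r, hr, hball⟩ := Metric.isOpen_iff.1 hK.isOpen_compl x (htK hx)
    have : ∀ᶠ y in 𝓝 x, y ∈ Metric.ball x (r / 2) := Metric.ball_mem_nhds x (half_pos hr)
    refine (this.filter_mono nhdsWithin_le_nhds).mono fun y hy ↦ ?_
    have h1 : HasRatioLog K x y := by
      refine hasRatioLog_of_dist_lt fun z hz ↦ ?_
      have hz' : r ≤ dist z x := not_lt.1 fun hlt ↦ hball (Metric.mem_ball.2 hlt) hz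
      rw [Metric.mem_ball] at hy
      rw [← dist_eq_norm, ← dist_eq_norm]
      linarith [dist_triangle z y x]
    exact ⟨h1, h1.symm⟩
  · intro x y z _ hy _ hxy hyz
    exact hxy.trans (htK hy) hyz

/-- A continuous function with exponential `1` is constant on connected sets. -/
theorem IsPreconnected.eq_of_exp_eq_one {S : Set ℂ} (hS : IsPreconnected S) {d : ℂ → ℂ}
    (hd : ContinuousOn d S) (h1 : ∀ z ∈ S, Complex.exp (d z) = 1) {z w : ℂ} (hz : z ∈ S)
    (hw : w ∈ S) : d z = d w := by
  refine hS.induction₂' (fun z w ↦ d z = d w) (fun x hx ↦ ?_) ?_ hz hw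
  · have := (hd x hx).eventually (Metric.ball_mem_nhds (d x) one_pos)
    filter_upwards [this, self_mem_nhdsWithin] with y hy hyS
    have key : d y = d x := by
      have h2 : Complex.exp (d y - d x) = 1 := by
        rw [Complex.exp_sub, h1 y hyS, h1 x hx, div_one]
      obtain ⟨n, hn⟩ := Complex.exp_eq_one_iff.1 h2
      rw [dist_eq_norm, hn] at hy
      have h3 : ‖(n : ℂ) * (2 * Real.pi * Complex.I)‖ = |(n : ℝ)| * (2 * Real.pi) := by
        simp [abs_of_pos Real.pi_pos]
      rw [h3] at hy
      have hn0 : n = 0 := by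
        by_contra hne
        have : (1 : ℝ) ≤ |(n : ℝ)| := by exact_mod_cast Int.one_le_abs hne
        nlinarith [Real.pi_gt_three]
      rw [hn0] at hn
      simpa [sub_eq_zero] using hn
    exact ⟨key.symm, key⟩
  · intro x y z _ _ _ h h'
    exact h.trans h'

/-- `z ↦ z - p` has no continuous logarithm on a circle around `p`. -/
theorem no_log_on_sphere (p : ℂ) {R : ℝ} (hR : 0 < R) (g : ℂ → ℂ)
    (hg : ContinuousOn g (Metric.sphere p R))
    (h : ∀ z ∈ Metric.sphere p R, Complex.exp (g z) = z - p) : False := by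
  have hmem : ∀ z : ℂ, p + R * Complex.exp (z.re * Complex.I) ∈ Metric.sphere p R := fun z ↦ by
    rw [mem_sphere_iff_norm, add_sub_cancel_left, norm_mul, Complex.norm_exp_ofReal_mul_I,
      Complex.norm_real, Real.norm_of_nonneg hR.le, mul_one]
  have hcont : Continuous fun z : ℂ ↦ g (p + R * Complex.exp (z.re * Complex.I)) :=
    hg.comp_continuous (by fun_prop) hmem
  -- The difference is constant, but between the parameters `0` and `2π` the first term returns to
  -- its value while the second changes by `2πi`. The parameter is complex, with only its real part
  -- used, to fit the form of `eq_of_exp_eq_one`.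
  have key := isPreconnected_univ.eq_of_exp_eq_one
    (d := fun z ↦ g (p + R * Complex.exp (z.re * Complex.I)) - z.re * Complex.I - Real.log R)
    ((hcont.sub ((Complex.continuous_ofReal.comp Complex.continuous_re).mul
      continuous_const)).sub continuous_const).continuousOn (fun z _ ↦ by
      rw [Complex.exp_sub, Complex.exp_sub, h _ (hmem z), ← Complex.ofReal_exp, Real.exp_log hR,
        add_sub_cancel_left]
      have : (R : ℂ) ≠ 0 := by exact_mod_cast hR.ne'
      field_simp [Complex.exp_ne_zero])
    (mem_univ (0 : ℂ)) (mem_univ ((2 * Real.pi : ℝ) : ℂ))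
  simp [Complex.exp_two_pi_mul_I, sub_eq_add_neg] at key

/-- A nowhere vanishing continuous function on a contractible space has a continuous logarithm. -/
theorem exists_log_of_continuous {X : Type*} [TopologicalSpace X] [ContractibleSpace X]
    [LocallyPathConnectedSpace X] {f : X → ℂ} (hf : Continuous f) (h0 : ∀ z, f z ≠ 0) :
    ∃ g : X → ℂ, Continuous g ∧ ∀ z, Complex.exp (g z) = f z := by
  obtain ⟨x₀⟩ : Nonempty X := inferInstance
  obtain ⟨g, ⟨-, hg⟩, -⟩ := Complex.isCoveringMapOn_exp.existsUnique_continuousMap_lifts ⟨f, hf⟩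
    (Complex.exp_log (h0 x₀)) h0
  exact ⟨g, g.continuous, fun z ↦ congr_fun hg z⟩

/-- The boundary of a component of the complement of a closed set lies in that set. -/
theorem IsClosed.frontier_connectedComponentIn_compl_subset {K : Set ℂ} (hK : IsClosed K) (p : ℂ) :
    frontier (connectedComponentIn Kᶜ p) ⊆ K := by
  intro z hz
  by_contra hzK
  have hVo : IsOpen (connectedComponentIn Kᶜ z) := hK.isOpen_compl.connectedComponentIn
  have hUo : IsOpen (connectedComponentIn Kᶜ p) := hK.isOpen_compl.connectedComponentIn
  obtain ⟨w, hwV, hwU⟩ := mem_closure_iff.1 (frontier_subset_closure hz) _ hVo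
    (mem_connectedComponentIn hzK)
  have : z ∈ connectedComponentIn Kᶜ p := by
    rw [connectedComponentIn_eq hwU, ← connectedComponentIn_eq hwV]
    exact mem_connectedComponentIn hzK
  rw [hUo.frontier_eq] at hz
  exact hz.2 this

theorem isPreconnected_compl_closedBall (R : ℝ) : IsPreconnected (Metric.closedBall (0 : ℂ) R)ᶜ := by
  rcases lt_or_ge R 0 with hR | hR
  · rw [Metric.closedBall_eq_empty.2 hR, compl_empty]; exact isPreconnected_univ
  have h1 : IsPreconnected (Metric.sphere (0 : ℂ) 1) :=
    isPreconnected_sphere (by simp) 0 1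
  have h2 := ((isPreconnected_Ioi (a := R)).prod h1).image (fun x : ℝ × ℂ ↦ x.1 • x.2)
    (by fun_prop)
  convert! h2 using 1
  ext z
  simp only [mem_compl_iff, Metric.mem_closedBall, dist_zero_right, not_le, mem_image, mem_prod,
    mem_Ioi, mem_sphere_iff_norm, sub_zero, Prod.exists]
  constructor
  · intro hz
    have : ‖z‖ ≠ 0 := by linarith
    refine ⟨‖z‖, (‖z‖⁻¹ : ℝ) • z, ⟨hz, ?_⟩, ?_⟩
    · rw [norm_smul, norm_inv, norm_norm, inv_mul_cancel₀ this]
    · rw [smul_smul, mul_inv_cancel₀ this, one_smul]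
  · rintro ⟨r, w, ⟨hr, hw⟩, rfl⟩
    rw [norm_smul, hw, mul_one, Real.norm_of_nonneg (by linarith)]
    exact hr

/-- Extend the logarithm by Tietze and replace `z - p` on the component by `exp (G z) * (z - q)`.
The two formulas agree on the boundary, and the new function has no zero, as `p` is inside and `q`
outside. So it has a logarithm on the whole plane, and with it `z - p` has one on a large circle
around `p`, which is impossible. -/
theorem not_hasRatioLog_of_bounded_component {K : Set ℂ} (hK : IsClosed K) {p q : ℂ} (hp : p ∉ K)
    (hq : q ∉ K) (hqU : q ∉ connectedComponentIn Kᶜ p)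
    (hb : Bornology.IsBounded (connectedComponentIn Kᶜ p)) : ¬ HasRatioLog K p q := by
  rintro ⟨g, hg, he⟩
  set U := connectedComponentIn Kᶜ p with hU
  have hfr : frontier U ⊆ K := hK.frontier_connectedComponentIn_compl_subset p
  obtain ⟨G, hG⟩ := ContinuousMap.exists_restrict_eq hK ⟨K.domRestrict g, hg.domRestrict⟩
  have hG' : ∀ z ∈ K, G z = g z := fun z hz ↦ by
    exact congr_fun (congr_arg DFunLike.coe hG) ⟨z, hz⟩
  classical
  have hne : ∀ z ∈ K, z - q ≠ 0 := fun z hz h0 ↦ hq (by rwa [← sub_eq_zero.1 h0])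
  have hfc : Continuous (U.piecewise (fun z ↦ Complex.exp (G z) * (z - q)) (fun z ↦ z - p)) := by
    refine Continuous.piecewise (fun z hz ↦ ?_) (by fun_prop) (by fun_prop)
    rw [hG' z (hfr hz), he z (hfr hz), div_mul_cancel₀ _ (hne z (hfr hz))]
  obtain ⟨l, hl, hle⟩ := exists_log_of_continuous hfc fun z ↦ by
    by_cases hz : z ∈ U
    · rw [piecewise_eq_of_mem _ _ _ hz]
      refine mul_ne_zero (Complex.exp_ne_zero _) fun h0 ↦ hqU (by rwa [← sub_eq_zero.1 h0])
    · rw [piecewise_eq_of_notMem _ _ _ hz]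
      exact fun h0 ↦ hz (by rw [sub_eq_zero.1 h0]; exact mem_connectedComponentIn hp)
  obtain ⟨R, hR0, hR⟩ : ∃ R : ℝ, 0 < R ∧ U ⊆ Metric.ball p R := by
    obtain ⟨R, hR⟩ := hb.subset_ball p
    exact ⟨max R 1, by positivity, hR.trans (Metric.ball_subset_ball (le_max_left _ _))⟩
  refine no_log_on_sphere p hR0 l hl.continuousOn fun z hz ↦ ?_
  rw [hle, piecewise_eq_of_notMem]
  exact fun hzU ↦ (Metric.mem_ball.1 (hR hzU)).ne (Metric.mem_sphere.1 hz)

/-- Eilenberg's criterion. -/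
theorem HasRatioLog.notSeparated {K : Set ℂ} (hK : IsCompact K) {p q : ℂ} (hp : p ∉ K)
    (hq : q ∉ K) (h : HasRatioLog K p q) : NotSeparated K p q := by
  by_cases hqU : q ∈ connectedComponentIn Kᶜ p
  · exact ⟨_, isPreconnected_connectedComponentIn, connectedComponentIn_subset _ _,
      mem_connectedComponentIn hp, hqU⟩
  exfalso
  have hpV : p ∉ connectedComponentIn Kᶜ q := fun hpV ↦ hqU (by
    rw [← connectedComponentIn_eq hpV]; exact mem_connectedComponentIn hq)
  obtain ⟨R, hR⟩ := hK.isBounded.subset_closedBall (0 : ℂ)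
  -- Every unbounded component contains the outside of a large disc, so of two distinct components
  -- at least one is bounded.
  have hub : ∀ w, ¬ Bornology.IsBounded (connectedComponentIn Kᶜ w) →
      (Metric.closedBall (0 : ℂ) R)ᶜ ⊆ connectedComponentIn Kᶜ w := by
    intro w hw
    obtain ⟨z, hz, hzR⟩ := not_subset.1 fun hs ↦ hw (Metric.isBounded_closedBall.subset hs)
    rw [connectedComponentIn_eq hz]
    exact (isPreconnected_compl_closedBall R).subset_connectedComponentIn hzR
      (compl_subset_compl.2 hR)
  by_cases hb : Bornology.IsBounded (connectedComponentIn Kᶜ p)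
  · exact not_hasRatioLog_of_bounded_component hK.isClosed hp hq hqU hb h
  by_cases hb' : Bornology.IsBounded (connectedComponentIn Kᶜ q)
  · exact not_hasRatioLog_of_bounded_component hK.isClosed hq hp hpV hb' h.symm
  have hz : (((R ⊔ 0) + 1 : ℝ) : ℂ) ∈ (Metric.closedBall (0 : ℂ) R)ᶜ := by
    rw [mem_compl_iff, Metric.mem_closedBall, dist_zero_right, Complex.norm_real,
      Real.norm_of_nonneg (by positivity), not_le]
    linarith [le_max_left R 0]
  apply hqU
  rw [connectedComponentIn_eq (hub p hb hz), ← connectedComponentIn_eq (hub q hb' hz)]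
  exact mem_connectedComponentIn hq

/-- On the connected intersection the two logarithms differ by a constant, which can be absorbed
into one of them. The gluing of continuity is left as the hypothesis `hu`, so that the lemma serves
pairs of closed sets and pairs of open sets. -/
theorem HasRatioLog.union {A B : Set ℂ} (hAB : IsPreconnected (A ∩ B))
    (hu : ∀ f : ℂ → ℂ, ContinuousOn f A → ContinuousOn f B → ContinuousOn f (A ∪ B)) {p q : ℂ}
    (h : HasRatioLog A p q) (h' : HasRatioLog B p q) : HasRatioLog (A ∪ B) p q := by
  obtain ⟨g, hg, he⟩ := h
  obtain ⟨g', hg', he'⟩ := h'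
  have hpq : ∀ z ∈ A ∩ B, (z - p) / (z - q) ≠ 0 := fun z hz ↦ by
    rw [← he z hz.1]; exact Complex.exp_ne_zero _
  have hexp : ∀ z ∈ A ∩ B, Complex.exp (g z - g' z) = 1 := fun z hz ↦ by
    rw [Complex.exp_sub, he z hz.1, he' z hz.2, div_self (hpq z hz)]
  obtain ⟨c, hc1, hc⟩ : ∃ c : ℂ, Complex.exp c = 1 ∧ ∀ z ∈ A ∩ B, g z - g' z = c := by
    rcases (A ∩ B).eq_empty_or_nonempty with hem | ⟨w, hw⟩
    · exact ⟨0, Complex.exp_zero, fun z hz ↦ absurd hz (by simp [hem])⟩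
    · exact ⟨g w - g' w, hexp w hw, fun z hz ↦ hAB.eq_of_exp_eq_one (d := fun z ↦ g z - g' z)
        ((hg.mono inter_subset_left).sub (hg'.mono inter_subset_right)) hexp hz hw⟩
  classical
  have hB' : ∀ z ∈ B, A.piecewise g (fun z ↦ g' z + c) z = g' z + c := fun z hz ↦ by
    by_cases hzA : z ∈ A
    · rw [piecewise_eq_of_mem _ _ _ hzA, ← hc z ⟨hzA, hz⟩]; ring
    · rw [piecewise_eq_of_notMem _ _ _ hzA]
  refine ⟨A.piecewise g (fun z ↦ g' z + c), hu _ ?_ ?_, fun z hz ↦ ?_⟩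
  · exact hg.congr fun z hz ↦ piecewise_eq_of_mem _ _ _ hz
  · exact (hg'.add continuousOn_const).congr hB'
  · by_cases hzA : z ∈ A
    · rw [piecewise_eq_of_mem _ _ _ hzA, he z hzA]
    · have hzB := hz.resolve_left hzA
      rw [hB' z hzB, Complex.exp_add, hc1, mul_one, he' z hzB]

/-- Janiszewski's theorem. -/
theorem NotSeparated.union {A B : Set ℂ} (hA : IsCompact A) (hB : IsCompact B)
    (hAB : IsPreconnected (A ∩ B)) {p q : ℂ} (h : NotSeparated A p q) (h' : NotSeparated B p q) :
    NotSeparated (A ∪ B) p q :=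
  HasRatioLog.notSeparated (hA.union hB) (fun hm ↦ hm.elim h.left_notMem h'.left_notMem)
    (fun hm ↦ hm.elim h.right_notMem h'.right_notMem)
    ((h.hasRatioLog hA.isClosed).union hAB
      (fun _ hf hf' ↦ hf.union_of_isClosed hf' hA.isClosed hB.isClosed)
      (h'.hasRatioLog hB.isClosed))

/-- An arc does not separate the plane. -/
theorem notSeparated_image_Icc {f : ℝ → ℂ} {s t : ℝ} (hst : s ≤ t) (hf : ContinuousOn f (Icc s t))
    (hinj : InjOn f (Icc s t)) {p q : ℂ} (hp : p ∉ f '' Icc s t) (hq : q ∉ f '' Icc s t) :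
    NotSeparated (f '' Icc s t) p q := by
  refine HasRatioLog.notSeparated (isCompact_Icc.image_of_continuousOn hf) hp hq ?_
  -- Along the parametrization, extended constantly to the contractible line, the ratio has a
  -- logarithm. Injectivity carries it to the arc, and Tietze extends it to the plane.
  have hF : Continuous (IccExtend hst ((Icc s t).domRestrict f)) := hf.domRestrict.Icc_extend'
  have hmem : ∀ x, IccExtend hst ((Icc s t).domRestrict f) x ∈ f '' Icc s t := fun x ↦
    ⟨projIcc s t hst x, (projIcc s t hst x).2, rfl⟩
  have hne : ∀ {w}, w ∉ f '' Icc s t → ∀ x, IccExtend hst ((Icc s t).domRestrict f) x - w ≠ 0 :=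
    fun hw x h0 ↦ hw (by rw [← sub_eq_zero.1 h0]; exact hmem x)
  obtain ⟨l, hl, hle⟩ := exists_log_of_continuous
    (f := fun x ↦ (IccExtend hst ((Icc s t).domRestrict f) x - p) /
      (IccExtend hst ((Icc s t).domRestrict f) x - q))
    ((hF.sub continuous_const).div (hF.sub continuous_const) (hne hq)) (fun x ↦ div_ne_zero (hne hp x) (hne hq x))
  have hemb : IsClosedEmbedding ((Icc s t).domRestrict f) :=
    hf.domRestrict.isClosedEmbedding (injOn_iff_injective.1 hinj)
  obtain ⟨G, hG⟩ := ContinuousMap.exists_extension' hemb ⟨fun x : Icc s t ↦ l x, by fun_prop⟩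
  refine ⟨G, G.continuous.continuousOn, ?_⟩
  rintro _ ⟨x, hx, rfl⟩
  have h1 : G (f x) = l x := congr_fun hG ⟨x, hx⟩
  rw [h1, hle, IccExtend_of_mem hst _ hx]
  rfl

/-- Moving the zero from `b` to `a` along the path deforms the constant `1` into the ratio without
meeting zero; the homotopy lifts through `exp`. -/
theorem Path.hasRatioLog_compl_range {a b : ℂ} (γ : Path a b) : HasRatioLog (range γ)ᶜ a b := by
  let A : Set ℂ := (range γ)ᶜ
  have hne : ∀ (z : A) (t), (z : ℂ) - γ t ≠ 0 := fun z t h0 ↦ z.2 ⟨t, (sub_eq_zero.1 h0).symm⟩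
  have hb : ∀ z : A, (z : ℂ) - b ≠ 0 := fun z ↦ by simpa using hne z 1
  let H : C(unitInterval × A, {z : ℂ // z ≠ 0}) :=
    ⟨fun x ↦ ⟨((x.2 : ℂ) - γ.symm x.1) / (x.2 - b), div_ne_zero (hne _ _) (hb _)⟩, by
      refine Continuous.subtype_mk (Continuous.div ?_ ?_ fun x ↦ hb _) _ <;> fun_prop⟩
  have H0 : ∀ z : A, H (0, z) = ⟨Complex.exp ((0 : C(A, ℂ)) z), Complex.exp_ne_zero _⟩ := fun z ↦ by
    apply Subtype.ext
    simp [H, div_self (hb z)]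
  let L := Complex.isCoveringMap_exp.liftHomotopy H 0 H0
  have hL : ∀ x, Complex.exp (L x) = H x := fun x ↦
    congr_arg Subtype.val (congr_fun (Complex.isCoveringMap_exp.liftHomotopy_lifts H 0 H0) x)
  classical
  refine ⟨fun z ↦ if h : z ∈ A then L (1, ⟨z, h⟩) else 0, ?_, fun z hz ↦ ?_⟩
  · rw [continuousOn_iff_continuous_domRestrict]
    have : Continuous fun z : A ↦ L (1, z) := by fun_prop
    convert! this using 1
    ext z
    exact dif_pos z.2
  · simp only [dif_pos (show z ∈ A from hz), hL]
    simp [H]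

/-- On the circle around `a` of radius `‖a - b‖ / 2` the function `z - b` has a logarithm, so `z -
a` would have one too. -/
theorem not_hasRatioLog_compl_pair {a b : ℂ} (hab : a ≠ b) : ¬ HasRatioLog {a, b}ᶜ a b := by
  rintro ⟨g, hg, he⟩
  have hab' : a - b ≠ 0 := sub_ne_zero.2 hab
  have hr : 0 < ‖a - b‖ / 2 := half_pos (norm_pos_iff.2 hab')
  have hb : ∀ z ∈ Metric.sphere a (‖a - b‖ / 2), ‖z - a‖ < ‖a - b‖ := fun z hz ↦ by
    rw [mem_sphere_iff_norm.1 hz]; linarith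
  have hsub : Metric.sphere a (‖a - b‖ / 2) ⊆ {a, b}ᶜ := by
    rintro z hz (rfl | rfl)
    · exact hr.ne (by simpa using hz)
    · have := hb z hz
      rw [norm_sub_rev] at this
      exact lt_irrefl _ this
  have hsp : ∀ z ∈ Metric.sphere a (‖a - b‖ / 2), (z - b) / (a - b) ∈ Complex.slitPlane := by
    intro z hz
    have h1 : (z - b) / (a - b) = 1 + (z - a) / (a - b) := by field_simp; ring
    rw [h1]
    apply Complex.mem_slitPlane_of_norm_lt_one
    rw [norm_div, div_lt_one (norm_pos_iff.2 hab')]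
    exact hb z hz
  refine no_log_on_sphere a hr
    (fun z ↦ g z + (Complex.log ((z - b) / (a - b)) + Complex.log (a - b))) ?_ fun z hz ↦ ?_
  · refine (hg.mono hsub).add (ContinuousOn.add (ContinuousOn.clog (by fun_prop) hsp) (by fun_prop))
  · have hzb : z - b ≠ 0 := fun h0 ↦ hsub hz (by simp [sub_eq_zero.1 h0])
    rw [Complex.exp_add, Complex.exp_add, he z (hsub hz), Complex.exp_log hab',
      Complex.exp_log (Complex.slitPlane_ne_zero (hsp z hz))]
    field_simp

/-- Two closed sets that join the same two points and meet only there separate the plane. -/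
theorem not_isPreconnected_compl_union {A B : Set ℂ} (hA : IsClosed A) (hB : IsClosed B) {a b : ℂ}
    (hab : a ≠ b) (hAj : JoinedIn A a b) (hBj : JoinedIn B a b) (hAB : A ∩ B ⊆ {a, b}) :
    ¬ IsPreconnected (A ∪ B)ᶜ := by
  intro hconn
  have key : ∀ {S : Set ℂ}, JoinedIn S a b → HasRatioLog Sᶜ a b := by
    rintro S ⟨γ, hγ⟩
    obtain ⟨g, hg, he⟩ := γ.hasRatioLog_compl_range
    have hsub : Sᶜ ⊆ (range γ)ᶜ := compl_subset_compl.2 (range_subset_iff.2 hγ)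
    exact ⟨g, hg.mono hsub, fun z hz ↦ he z (hsub hz)⟩
  -- Were the intersection of the two open complements connected, their logarithms would glue to one
  -- on the complement of `A ∩ B`, hence off `{a, b}`.
  rw [compl_union] at hconn
  obtain ⟨g, hg, he⟩ := (key hAj).union hconn
    (fun f hf hf' ↦ hf.union_of_isOpen hf' hA.isOpen_compl hB.isOpen_compl) (key hBj)
  rw [← compl_inter] at hg he
  exact not_hasRatioLog_compl_pair hab ⟨g, hg.mono (compl_subset_compl.2 hAB),
    fun z hz ↦ he z (compl_subset_compl.2 hAB hz)⟩

theorem NotSeparated.symm {K : Set ℂ} {p q : ℂ} (h : NotSeparated K p q) : NotSeparated K q p := by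
  obtain ⟨t, ht, htK, hp, hq⟩ := h
  exact ⟨t, ht, htK, hq, hp⟩

theorem NotSeparated.trans {K : Set ℂ} {p q r : ℂ} (h : NotSeparated K p q)
    (h' : NotSeparated K q r) : NotSeparated K p r := by
  obtain ⟨t, ht, htK, hp, hq⟩ := h
  obtain ⟨t', ht', htK', hq', hr⟩ := h'
  exact ⟨t ∪ t', ht.union q hq hq' ht', union_subset htK htK', Or.inl hp, Or.inr hr⟩

theorem NotSeparated.mono {K K' : Set ℂ} (hK : K' ⊆ K) {p q : ℂ} (h : NotSeparated K p q) :
    NotSeparated K' p q := by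
  obtain ⟨t, ht, htK, hp, hq⟩ := h
  exact ⟨t, ht, htK.trans (compl_subset_compl.2 hK), hp, hq⟩

theorem NotSeparated.connectedComponentIn_eq {K : Set ℂ} {p q : ℂ} (h : NotSeparated K p q) :
    connectedComponentIn Kᶜ p = connectedComponentIn Kᶜ q := by
  obtain ⟨t, ht, htK, hp, hq⟩ := h
  exact _root_.connectedComponentIn_eq (ht.subset_connectedComponentIn hp htK hq)

theorem IsPreconnected.inter_frontier_nonempty_of_isOpen {t D : Set ℂ} (ht : IsPreconnected t)
    (hD : IsOpen D) {p q : ℂ} (hp : p ∈ t) (hq : q ∈ t) (hpD : p ∈ D) (hqD : q ∉ D) :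
    (t ∩ frontier D).Nonempty := by
  by_contra hem
  rw [not_nonempty_iff_eq_empty] at hem
  have hsub : t ⊆ D ∪ (closure D)ᶜ := fun z hz ↦ by
    by_contra hz'
    rw [mem_union, not_or, mem_compl_iff, not_not] at hz'
    have : z ∈ t ∩ frontier D := ⟨hz, by rw [hD.frontier_eq]; exact ⟨hz'.2, hz'.1⟩⟩
    rw [hem] at this
    exact this
  exact hqD (ht.subset_left_of_subset_union hD isClosed_closure.isOpen_compl
    (disjoint_compl_right.mono_left subset_closure) hsub ⟨p, hp, hpD⟩ hq)

/-! ### Drawings of subgraphs -/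

namespace PlanarEmbedding

variable {V : Type*} {G : SimpleGraph V} (E : PlanarEmbedding G)

theorem exists_param {u v : V} (h : G.Adj u v) : ∃ f : ℝ → ℂ, Continuous f ∧
    InjOn f (Icc 0 1) ∧ f 0 = E.point u ∧ f 1 = E.point v ∧ f '' Icc 0 1 = E.arc s(u, v) := by
  obtain ⟨γ, hγ, hr⟩ := E.isPlaneArc u v h
  refine ⟨γ.extend, γ.continuous_extend, ?_, by simp, by simp, ?_⟩
  · intro x hx y hy hxy
    rw [γ.extend_apply hx, γ.extend_apply hy] at hxy
    exact congr_arg Subtype.val (hγ hxy)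
  · rw [← hr]
    ext z
    constructor
    · rintro ⟨x, hx, rfl⟩
      exact ⟨⟨x, hx⟩, (γ.extend_apply hx).symm⟩
    · rintro ⟨x, rfl⟩
      exact ⟨x, x.2, γ.extend_apply x.2⟩

theorem isCompact_arc {e : Sym2 V} (he : e ∈ G.edgeSet) : IsCompact (E.arc e) := by
  induction e with | _ u v
  obtain ⟨f, hf, -, -, -, hr⟩ := E.exists_param he
  rw [← hr]
  exact isCompact_Icc.image hf

theorem isPreconnected_arc {e : Sym2 V} (he : e ∈ G.edgeSet) : IsPreconnected (E.arc e) := by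
  induction e with | _ u v
  obtain ⟨f, hf, -, -, -, hr⟩ := E.exists_param he
  rw [← hr]
  exact isPreconnected_Icc.image f hf.continuousOn

theorem point_mem_arc {e : Sym2 V} (he : e ∈ G.edgeSet) {w : V} (hw : w ∈ e) :
    E.point w ∈ E.arc e := by
  induction e with | _ u v
  obtain ⟨f, -, -, h0, h1, hr⟩ := E.exists_param he
  rw [← hr]
  rcases Sym2.mem_iff.1 hw with rfl | rfl
  · exact ⟨0, by simp, h0⟩
  · exact ⟨1, by simp, h1⟩

theorem joinedIn_arc {u v : V} (h : G.Adj u v) :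
    JoinedIn (E.arc s(u, v)) (E.point u) (E.point v) := by
  obtain ⟨γ, -, hr⟩ := E.isPlaneArc u v h
  exact ⟨γ, fun t ↦ hr ▸ mem_range_self t⟩

/-- The point set of an embedded subgraph. -/
def drawing (H : G.Subgraph) : Set ℂ := E.point '' H.verts ∪ ⋃ e ∈ H.edgeSet, E.arc e

theorem mem_drawing {H : G.Subgraph} {z : ℂ} :
    z ∈ E.drawing H ↔ (∃ w ∈ H.verts, E.point w = z) ∨ ∃ e ∈ H.edgeSet, z ∈ E.arc e := by
  simp [drawing]

theorem arc_subset_drawing {H : G.Subgraph} {e : Sym2 V} (he : e ∈ H.edgeSet) :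
    E.arc e ⊆ E.drawing H := fun _ hz ↦ E.mem_drawing.2 (Or.inr ⟨e, he, hz⟩)

theorem drawing_subset_support (H : G.Subgraph) : E.drawing H ⊆ E.support := by
  intro z hz
  rcases E.mem_drawing.1 hz with ⟨w, -, rfl⟩ | ⟨e, he, hz⟩
  · exact Or.inl ⟨w, rfl⟩
  · exact Or.inr (mem_iUnion₂.2 ⟨e, H.edgeSet_subset he, hz⟩)

theorem point_mem_drawing {H : G.Subgraph} {w : V} : E.point w ∈ E.drawing H ↔ w ∈ H.verts := by
  rw [mem_drawing]
  constructor
  · rintro (⟨w', hw', h⟩ | ⟨e, he, h⟩)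
    · exact E.point_injective h ▸ hw'
    · exact H.mem_verts_of_mem_edge he (E.mem_of_point_mem_arc e (H.edgeSet_subset he) w h)
  · exact fun h ↦ Or.inl ⟨w, h, rfl⟩

theorem drawing_mono {H H' : G.Subgraph} (h : H ≤ H') : E.drawing H ⊆ E.drawing H' := by
  intro z hz
  rcases E.mem_drawing.1 hz with ⟨w, hw, rfl⟩ | ⟨e, he, hz⟩
  · exact E.point_mem_drawing.2 (h.1 hw)
  · exact E.arc_subset_drawing (SimpleGraph.Subgraph.edgeSet_mono h he) hz

theorem drawing_sup (H H' : G.Subgraph) : E.drawing (H ⊔ H') = E.drawing H ∪ E.drawing H' := by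
  ext z
  simp only [mem_drawing, mem_union, SimpleGraph.Subgraph.verts_sup,
    SimpleGraph.Subgraph.edgeSet_sup]
  grind

/-- Distinct edges meet only in nodes, so intersections of point sets become combinatorial; this is
how Janiszewski's theorem is applied to subgraphs. -/
theorem drawing_inf (H H' : G.Subgraph) : E.drawing (H ⊓ H') = E.drawing H ∩ E.drawing H' := by
  refine subset_antisymm (subset_inter (E.drawing_mono inf_le_left) (E.drawing_mono inf_le_right)) ?_
  rintro z ⟨hz, hz'⟩
  rcases E.mem_drawing.1 hz with ⟨w, hw, rfl⟩ | ⟨e, he, hze⟩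
  · exact E.point_mem_drawing.2 ⟨hw, E.point_mem_drawing.1 hz'⟩
  rcases E.mem_drawing.1 hz' with ⟨w, hw, rfl⟩ | ⟨e', he', hze'⟩
  · exact E.point_mem_drawing.2 ⟨E.point_mem_drawing.1 hz, hw⟩
  by_cases hee : e = e'
  · subst hee
    exact E.arc_subset_drawing (by rw [SimpleGraph.Subgraph.edgeSet_inf]; exact ⟨he, he'⟩) hze
  · obtain ⟨w, -, -, rfl⟩ := E.arc_inter e (H.edgeSet_subset he) e' (H'.edgeSet_subset he') hee z
      ⟨hze, hze'⟩
    exact E.point_mem_drawing.2 ⟨E.point_mem_drawing.1 hz, E.point_mem_drawing.1 hz'⟩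

theorem drawing_subgraphOfAdj {u v : V} (h : G.Adj u v) :
    E.drawing (G.subgraphOfAdj h) = E.arc s(u, v) := by
  ext z
  rw [mem_drawing, SimpleGraph.edgeSet_subgraphOfAdj]
  constructor
  · rintro (⟨w, hw, rfl⟩ | ⟨e, rfl, hz⟩)
    · exact E.point_mem_arc h (by simpa using hw)
    · exact hz
  · exact fun hz ↦ Or.inr ⟨_, rfl, hz⟩

theorem isCompact_drawing [Finite V] (H : G.Subgraph) : IsCompact (E.drawing H) :=
  ((toFinite _).image _).isCompact.union
    ((toFinite _).isCompact_biUnion fun _ he ↦ E.isCompact_arc (H.edgeSet_subset he))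

theorem joinedIn_drawing_toSubgraph {u v : V} (p : G.Walk u v) :
    JoinedIn (E.drawing p.toSubgraph) (E.point u) (E.point v) := by
  induction p with
  | nil => exact JoinedIn.refl (E.point_mem_drawing.2 (by simp))
  | cons h p ih =>
    rw [SimpleGraph.Walk.toSubgraph, drawing_sup, drawing_subgraphOfAdj]
    exact ((E.joinedIn_arc h).mono subset_union_left).trans (ih.mono subset_union_right)

theorem isPreconnected_drawing_of_forall {H : G.Subgraph} (w : V)
    (h : ∀ y ∈ H.verts, ∃ p : G.Walk w y, p.toSubgraph ≤ H) : IsPreconnected (E.drawing H) := by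
  have key : ∀ y ∈ H.verts, ∃ t ⊆ E.drawing H, E.point w ∈ t ∧ E.point y ∈ t ∧
      IsPreconnected t := fun y hy ↦ by
    obtain ⟨p, hp⟩ := h y hy
    obtain ⟨γ, hγ⟩ := E.joinedIn_drawing_toSubgraph p
    exact ⟨range γ, (range_subset_iff.2 hγ).trans (E.drawing_mono hp), ⟨0, by simp⟩, ⟨1, by simp⟩,
      isPreconnected_range γ.continuous⟩
  refine isPreconnected_of_forall (E.point w) fun z hz ↦ ?_
  rcases E.mem_drawing.1 hz with ⟨y, hy, rfl⟩ | ⟨e, he, hz⟩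
  · exact key y hy
  · induction e with | _ y y'
    obtain ⟨t, htH, hw, hy, ht⟩ := key y (H.edge_vert he)
    exact ⟨t ∪ E.arc s(y, y'), union_subset htH (E.arc_subset_drawing he), Or.inl hw, Or.inr hz,
      ht.union _ hy (E.point_mem_arc (H.edgeSet_subset he) (by simp))
        (E.isPreconnected_arc (H.edgeSet_subset he))⟩

theorem notSeparated_of_walk {K : G.Subgraph} {u v : V} (p : G.Walk u v)
    (h : ∀ w ∈ p.support, w ∉ K.verts) : NotSeparated (E.drawing K) (E.point u) (E.point v) := by
  obtain ⟨γ, hγ⟩ := E.joinedIn_drawing_toSubgraph p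
  refine ⟨range γ, isPreconnected_range γ.continuous, ?_, ⟨0, by simp⟩, ⟨1, by simp⟩⟩
  refine (range_subset_iff.2 hγ).trans fun z hz hzK ↦ ?_
  have hz' : z ∈ E.drawing (p.toSubgraph ⊓ K) := by rw [drawing_inf]; exact ⟨hz, hzK⟩
  rcases E.mem_drawing.1 hz' with ⟨w, hw, -⟩ | ⟨e, he, -⟩
  · exact h w (p.mem_verts_toSubgraph.1 hw.1) hw.2
  · induction e with | _ y y'
    have := SimpleGraph.Subgraph.edge_vert _ (SimpleGraph.Subgraph.mem_edgeSet.1 he)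
    exact h y (p.mem_verts_toSubgraph.1 this.1) this.2

/-- An embedded path does not separate the plane. -/
theorem notSeparated_path [Finite V] {u v : V} {p : G.Walk u v} (hp : p.IsPath) {z z' : ℂ}
    (hz : z ∉ E.drawing p.toSubgraph) (hz' : z' ∉ E.drawing p.toSubgraph) :
    NotSeparated (E.drawing p.toSubgraph) z z' := by
  induction p with
  | @nil u =>
    have : E.drawing (SimpleGraph.Walk.nil : G.Walk u u).toSubgraph = {E.point u} := by
      ext z
      simp [mem_drawing, eq_comm]
    rw [this] at hz hz' ⊢
    have := (isPathConnected_compl_singleton_of_one_lt_rank (E := ℂ) (by simp)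
      (E.point u)).isConnected.isPreconnected
    exact ⟨_, this, subset_rfl, hz, hz'⟩
  | @cons u v w h p ih =>
    rw [SimpleGraph.Walk.cons_isPath_iff] at hp
    rw [SimpleGraph.Walk.toSubgraph] at hz hz' ⊢
    rw [drawing_sup, mem_union, not_or] at hz hz'
    rw [drawing_sup]
    refine NotSeparated.union (E.isCompact_drawing _) (E.isCompact_drawing _) ?_ ?_
      (ih hp.1 hz.2 hz'.2)
    · rw [← drawing_inf]
      refine Subsingleton.isPreconnected (subsingleton_of_subset_singleton (a := E.point v) ?_)
      intro z hz
      have hmem : ∀ y ∈ (G.subgraphOfAdj h ⊓ p.toSubgraph).verts, y = v := by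
        rintro y ⟨hy, hy'⟩
        rw [SimpleGraph.Walk.mem_verts_toSubgraph] at hy'
        rcases hy with rfl | rfl
        · exact absurd hy' hp.2
        · rfl
      rcases E.mem_drawing.1 hz with ⟨y, hy, rfl⟩ | ⟨e, he, -⟩
      · rw [hmem y hy]; rfl
      · induction e with | _ y y'
        rw [SimpleGraph.Subgraph.mem_edgeSet] at he
        have h1 := hmem y (SimpleGraph.Subgraph.edge_vert _ he)
        have h2 := hmem y' (SimpleGraph.Subgraph.edge_vert _ he.symm)
        have h3 := SimpleGraph.Subgraph.adj_sub _ he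
        rw [h1, h2] at h3
        exact absurd h3 (G.loopless.irrefl v)
    · rw [drawing_subgraphOfAdj] at hz hz' ⊢
      obtain ⟨f, hf, hinj, -, -, hr⟩ := E.exists_param h
      rw [← hr] at hz hz' ⊢
      exact notSeparated_image_Icc zero_le_one hf.continuousOn hinj hz.1 hz'.1

/-- A cycle, consisting of an edge and a path, separates the plane, and the edge lies on the boundary
of every component of its complement. -/
theorem arc_subset_frontier_and_exists_notMem [Finite V] {x y : V} (h : G.Adj x y) {q : G.Walk y x} (hq : q.IsPath)
    (he : s(x, y) ∉ q.edges) {z : ℂ}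
    (hz : z ∉ E.drawing (G.subgraphOfAdj h ⊔ q.toSubgraph)) :
    (E.arc s(x, y) ⊆ frontier
      (connectedComponentIn (E.drawing (G.subgraphOfAdj h ⊔ q.toSubgraph))ᶜ z)) ∧
    ∃ z' ∉ E.drawing (G.subgraphOfAdj h ⊔ q.toSubgraph),
      z' ∉ connectedComponentIn (E.drawing (G.subgraphOfAdj h ⊔ q.toSubgraph))ᶜ z := by
  set J := E.drawing (G.subgraphOfAdj h ⊔ q.toSubgraph) with hJ
  have hJc : IsClosed J := (E.isCompact_drawing _).isClosed
  have hJe : J = E.arc s(x, y) ∪ E.drawing q.toSubgraph := by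
    rw [hJ, drawing_sup, drawing_subgraphOfAdj]
  have hint : E.arc s(x, y) ∩ E.drawing q.toSubgraph ⊆ {E.point x, E.point y} := by
    rw [← E.drawing_subgraphOfAdj h, ← drawing_inf]
    intro w hw
    rcases E.mem_drawing.1 hw with ⟨y', hy', rfl⟩ | ⟨e, he', -⟩
    · rcases hy'.1 with rfl | rfl
      · exact Or.inl rfl
      · exact Or.inr rfl
    · rw [SimpleGraph.Subgraph.edgeSet_inf, SimpleGraph.edgeSet_subgraphOfAdj] at he'
      obtain ⟨rfl, he'⟩ := he'
      exact absurd (q.mem_edges_toSubgraph.1 he') he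
  have hnc : ¬ IsPreconnected Jᶜ := by
    rw [hJe]
    exact not_isPreconnected_compl_union (E.isCompact_arc h).isClosed
      (E.isCompact_drawing _).isClosed (fun h' ↦ h.ne (E.point_injective h'))
      (E.joinedIn_arc h) (E.joinedIn_drawing_toSubgraph q).symm hint
  obtain ⟨z', hz', hz'D⟩ : ∃ z' ∉ J, z' ∉ connectedComponentIn Jᶜ z := by
    by_contra! hall
    have : Jᶜ = connectedComponentIn Jᶜ z :=
      subset_antisymm hall (connectedComponentIn_subset _ _)
    exact hnc (this ▸ isPreconnected_connectedComponentIn)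
  refine ⟨?_, z', hz', hz'D⟩
  set D := connectedComponentIn Jᶜ z
  have hDo : IsOpen D := hJc.isOpen_compl.connectedComponentIn
  have hfr : frontier D ⊆ J := hJc.frontier_connectedComponentIn_compl_subset z
  obtain ⟨f, hf, hinj, h0, h1, hr⟩ := E.exists_param h
  suffices hsuff : Ioo 0 1 ⊆ f ⁻¹' frontier D by
    rw [← hr, image_subset_iff, ← closure_Ioo zero_ne_one]
    exact closure_minimal hsuff (isClosed_frontier.preimage hf)
  -- An interior point of the edge off the boundary of `D` has a piece of the edge around it that is
  -- also off the boundary. Without this piece the cycle falls into `A`, `B` and `Q`, which by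
  -- Janiszewski's theorem do not separate `z` from `z'`. But a connected set from `z` to `z'` meets
  -- the boundary of `D`, which lies in the remaining part.
  intro t ht
  by_contra htD
  have hopen : IsOpen (Ioo 0 1 ∩ f ⁻¹' (frontier D)ᶜ) :=
    isOpen_Ioo.inter (isClosed_frontier.isOpen_compl.preimage hf)
  obtain ⟨ε, hε, hball⟩ := Metric.isOpen_iff.1 hopen t ⟨ht, htD⟩
  rw [Real.ball_eq_Ioo] at hball
  have hb0 : 0 ≤ t - ε / 2 := (hball ⟨by linarith, by linarith⟩ : t - ε / 2 ∈ _).1.1.le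
  have hb1 : t + ε / 2 ≤ 1 := (hball ⟨by linarith, by linarith⟩ : t + ε / 2 ∈ _).1.2.le
  set A := f '' Icc 0 (t - ε / 2) with hA
  set B := f '' Icc (t + ε / 2) 1 with hB
  set Q := E.drawing q.toSubgraph with hQ
  have hsA : Icc 0 (t - ε / 2) ⊆ Icc (0 : ℝ) 1 := Icc_subset_Icc_right (by linarith)
  have hsB : Icc (t + ε / 2) 1 ⊆ Icc (0 : ℝ) 1 := Icc_subset_Icc_left (by linarith)
  have hAJ : A ⊆ E.arc s(x, y) := hr ▸ image_mono hsA
  have hBJ : B ⊆ E.arc s(x, y) := hr ▸ image_mono hsB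
  have hsub : B ∪ (A ∪ Q) ⊆ J := by
    rw [hJe]
    exact union_subset (hBJ.trans subset_union_left) (union_subset_union_left _ hAJ)
  have hAc : IsCompact A := isCompact_Icc.image hf
  have hBc : IsCompact B := isCompact_Icc.image hf
  have hQc : IsCompact Q := E.isCompact_drawing _
  have hAQ : A ∩ Q ⊆ {f 0} := by
    rintro _ ⟨⟨r, hr', rfl⟩, hq'⟩
    rcases hint ⟨hAJ ⟨r, hr', rfl⟩, hq'⟩ with h' | h'
    · exact h'.trans h0.symm
    · have := hinj (hsA hr') (by simp) (h'.trans h1.symm)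
      linarith [hr'.2]
  have hBAQ : B ∩ (A ∪ Q) ⊆ {f 1} := by
    rintro _ ⟨⟨r, hr', rfl⟩, ⟨r', hr'', heq⟩ | hq'⟩
    · have := hinj (hsA hr'') (hsB hr') heq
      linarith [hr'.1, hr''.2]
    · rcases hint ⟨hBJ ⟨r, hr', rfl⟩, hq'⟩ with h' | h'
      · have := hinj (hsB hr') (by simp) (h'.trans h0.symm)
        linarith [hr'.1]
      · exact h'.trans h1.symm
  have hns : NotSeparated (B ∪ (A ∪ Q)) z z' := by
    have hz1 := fun hm ↦ hz (hsub hm)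
    have hz2 := fun hm ↦ hz' (hsub hm)
    refine NotSeparated.union hBc (hAc.union hQc)
      (subsingleton_of_subset_singleton hBAQ).isPreconnected ?_
      (NotSeparated.union hAc hQc (subsingleton_of_subset_singleton hAQ).isPreconnected ?_ ?_)
    · exact notSeparated_image_Icc hb1 hf.continuousOn (hinj.mono hsB) (fun hm ↦ hz1 (Or.inl hm))
        (fun hm ↦ hz2 (Or.inl hm))
    · exact notSeparated_image_Icc hb0 hf.continuousOn (hinj.mono hsA)
        (fun hm ↦ hz1 (Or.inr (Or.inl hm))) (fun hm ↦ hz2 (Or.inr (Or.inl hm)))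
    · exact E.notSeparated_path hq (fun hm ↦ hz1 (Or.inr (Or.inr hm)))
        (fun hm ↦ hz2 (Or.inr (Or.inr hm)))
  obtain ⟨s, hs, hsK, hzs, hz's⟩ := hns
  obtain ⟨w, hws, hwD⟩ := hs.inter_frontier_nonempty_of_isOpen hDo hzs hz's
    (mem_connectedComponentIn hz) hz'D
  apply hsK hws
  have hwJ := hfr hwD
  rw [hJe, ← hr] at hwJ
  rcases hwJ with ⟨r, hr', rfl⟩ | hwq
  · rcases le_or_gt r (t - ε / 2) with h2 | h2
    · exact Or.inr (Or.inl ⟨r, ⟨hr'.1, h2⟩, rfl⟩)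
    rcases le_or_gt (t + ε / 2) r with h3 | h3
    · exact Or.inl ⟨r, ⟨h3, hr'.2⟩, rfl⟩
    exact absurd hwD (hball ⟨by linarith, by linarith⟩ : r ∈ _).2
  · exact Or.inr (Or.inr hwq)

end PlanarEmbedding

/-! ### Cycles cut open at an edge -/

namespace SimpleGraph.Walk

variable {V : Type*} {G : SimpleGraph V}

theorem exists_eq_append_cons_of_mem_edges {u v : V} (p : G.Walk u v) {e : Sym2 V}
    (he : e ∈ p.edges) : ∃ (x y : V) (h : G.Adj x y) (p₁ : G.Walk u x) (p₂ : G.Walk y v),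
      e = s(x, y) ∧ p = p₁.append (cons h p₂) := by
  induction p with
  | nil => simp at he
  | @cons u w v h p ih =>
    rw [edges_cons, List.mem_cons] at he
    rcases he with rfl | he
    · exact ⟨u, w, h, nil, p, rfl, rfl⟩
    · obtain ⟨x, y, h', p₁, p₂, rfl, rfl⟩ := ih he
      exact ⟨x, y, h', cons h p₁, p₂, rfl, rfl⟩

/-- A cycle consists of any one of its edges and a path. -/
theorem IsCycle.exists_adj_path {u : V} {c : G.Walk u u} (hc : c.IsCycle) {e : Sym2 V}
    (he : e ∈ c.edges) : ∃ (x y : V) (h : G.Adj x y) (q : G.Walk y x), e = s(x, y) ∧ q.IsPath ∧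
      s(x, y) ∉ q.edges ∧ (∀ w, w ∈ c.support ↔ w ∈ q.support) ∧
      c.toSubgraph = G.subgraphOfAdj h ⊔ q.toSubgraph := by
  cases c with
  | nil => simp at he
  | @cons _ v _ h p =>
    have hc' := (cons_isCycle_iff p h).1 hc
    rw [edges_cons, List.mem_cons] at he
    rcases he with rfl | he
    · refine ⟨u, v, h, p, rfl, hc'.1, hc'.2, fun w ↦ ?_, rfl⟩
      rw [support_cons, List.mem_cons]
      exact ⟨fun h ↦ h.elim (fun h ↦ h ▸ p.end_mem_support) id, Or.inr⟩
    · obtain ⟨x, y, h', p₁, p₂, rfl, rfl⟩ := p.exists_eq_append_cons_of_mem_edges he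
      refine ⟨x, y, h', p₂.append (cons h p₁), rfl, ?_, ?_, fun w ↦ ?_, ?_⟩
      · have := hc'.1.support_nodup
        rw [isPath_def]
        simp only [support_append, support_cons, List.tail_cons] at this ⊢
        exact (List.perm_append_comm.nodup_iff).1 this
      · have := hc.edges_nodup
        simp only [edges_cons, edges_append, List.nodup_cons, List.nodup_append, List.mem_append,
          List.mem_cons] at this ⊢
        grind
      · simp only [support_append, support_cons, List.tail_cons, List.mem_append, List.mem_cons]
        have := p₂.end_mem_support
        grind
      · have hcons : ∀ {a b d : V} (h : G.Adj a b) (p : G.Walk b d),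
            (cons h p).toSubgraph = G.subgraphOfAdj h ⊔ p.toSubgraph := fun _ _ ↦ rfl
        rw [hcons, toSubgraph_append, hcons, toSubgraph_append, hcons]
        ac_rfl

end SimpleGraph.Walk

/-! ### Faces bounded by cycles -/

namespace PlanarEmbedding

variable {V : Type*} {G : SimpleGraph V} (E : PlanarEmbedding G)

/-- A chordless cycle whose complement is connected bounds a face. -/
theorem exists_isFace_of_isCycle [Finite V] {r : V} {c : G.Walk r r} (hc : c.IsCycle)
    (hchord : ∀ e ∈ G.edgeSet, (∀ w ∈ e, w ∈ c.support) → e ∈ c.edges)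
    (hconn : ∀ s t, s ∉ c.support → t ∉ c.support →
      ∃ p : G.Walk s t, ∀ w ∈ p.support, w ∉ c.support) :
    ∃ z ∉ E.support,
      connectedComponentIn E.supportᶜ z = connectedComponentIn (E.drawing c.toSubgraph)ᶜ z ∧
      ∀ e ∈ c.edges, E.arc e ⊆ frontier (connectedComponentIn E.supportᶜ z) := by
  set J := E.drawing c.toSubgraph with hJ
  have hJs : J ⊆ E.support := E.drawing_subset_support _
  have harc : ∀ z, z ∉ J → ∀ e ∈ c.edges, E.arc e ⊆ frontier (connectedComponentIn Jᶜ z) ∧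
      ∃ z' ∉ J, z' ∉ connectedComponentIn Jᶜ z := by
    intro z hz e he
    obtain ⟨x, y, h, q, rfl, hq, hqe, -, hJe⟩ := hc.exists_adj_path he
    rw [hJ, hJe] at hz ⊢
    exact E.arc_subset_frontier_and_exists_notMem h hq hqe hz
  have hmemJ : ∀ {w}, E.point w ∈ J ↔ w ∈ c.support := fun {w} ↦
    E.point_mem_drawing.trans c.mem_verts_toSubgraph
  have hpp : ∀ s t, s ∉ c.support → t ∉ c.support →
      NotSeparated J (E.point s) (E.point t) := fun s t hs ht ↦ by
    obtain ⟨p, hp⟩ := hconn s t hs ht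
    exact E.notSeparated_of_walk p fun w hw ↦ by
      rw [SimpleGraph.Walk.mem_verts_toSubgraph]; exact hp w hw
  have hzp : ∀ z ∈ E.support, z ∉ J → ∃ s, s ∉ c.support ∧ NotSeparated J z (E.point s) := by
    intro z hz hzJ
    have hpt : ∀ s, E.point s = z → ∃ s, s ∉ c.support ∧ NotSeparated J z (E.point s) := by
      rintro s rfl
      exact ⟨s, fun hs ↦ hzJ (hmemJ.2 hs), {E.point s}, isPreconnected_singleton,
        singleton_subset_iff.2 hzJ, rfl, rfl⟩
    rcases hz with ⟨s, hs⟩ | hz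
    · exact hpt s hs
    obtain ⟨e, he, hze⟩ := mem_iUnion₂.1 hz
    -- Without chords, an edge outside the cycle has an end `s` off the cycle. The part of the edge
    -- from `s` to the given point can meet `J` only in the other end `t`.
    obtain ⟨s, hse, hs⟩ : ∃ s ∈ e, s ∉ c.support := by
      by_contra! hall
      exact hzJ (E.arc_subset_drawing (by
        rw [SimpleGraph.Walk.mem_edges_toSubgraph]; exact hchord e he hall) hze)
    obtain ⟨t, rfl⟩ := hse
    have hadj : G.Adj s t := he
    obtain ⟨f, hf, hinj, h0, h1, hr⟩ := E.exists_param hadj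
    change z ∈ E.arc s(s, t) at hze
    rw [← hr] at hze
    obtain ⟨x, hx, rfl⟩ := hze
    by_cases hx1 : x = 1
    · exact hpt t (by rw [hx1, h1])
    refine ⟨s, hs, f '' Icc 0 x, isPreconnected_Icc.image f hf.continuousOn, ?_,
      ⟨x, ⟨hx.1, le_rfl⟩, rfl⟩, ⟨0, ⟨le_rfl, hx.1⟩, h0⟩⟩
    rintro _ ⟨y, hy, rfl⟩ hyJ
    have hy1 : y ∈ Icc (0 : ℝ) 1 := ⟨hy.1, hy.2.trans hx.2⟩
    have hye : f y ∈ E.drawing (G.subgraphOfAdj hadj ⊓ c.toSubgraph) := by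
      rw [drawing_inf, drawing_subgraphOfAdj, ← hr]
      exact ⟨⟨y, hy1, rfl⟩, hyJ⟩
    rcases E.mem_drawing.1 hye with ⟨w, hw, hwy⟩ | ⟨e, he', -⟩
    · rcases hw.1 with rfl | rfl
      · exact hs (c.mem_verts_toSubgraph.1 hw.2)
      · have := hinj (by simp) hy1 (h1.trans hwy)
        exact hx1 (le_antisymm hx.2 (this ▸ hy.2))
    · rw [SimpleGraph.Subgraph.edgeSet_inf, SimpleGraph.edgeSet_subgraphOfAdj] at he'
      obtain ⟨rfl, he'⟩ := he'
      exact hs (c.fst_mem_support_of_mem_edges (c.mem_edges_toSubgraph.1 he'))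
  have hzz : ∀ z ∈ E.support, z ∉ J → ∀ z' ∈ E.support, z' ∉ J → NotSeparated J z z' := by
    intro z hz hzJ z' hz' hzJ'
    obtain ⟨s, hs, h⟩ := hzp z hz hzJ
    obtain ⟨t, ht, h'⟩ := hzp z' hz' hzJ'
    exact h.trans ((hpp s t hs ht).trans h'.symm)
  obtain ⟨e₀, he₀⟩ : ∃ e, e ∈ c.edges := by
    obtain ⟨e, he⟩ := List.exists_mem_of_length_pos (l := c.edges) (by
      rw [SimpleGraph.Walk.length_edges]; linarith [hc.three_le_length])
    exact ⟨e, he⟩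
  obtain ⟨z₀, hz₀⟩ : ∃ z₀, z₀ ∉ J := by
    by_contra! hall
    exact (E.isCompact_drawing c.toSubgraph).ne_univ (eq_univ_of_forall hall)
  -- The rest of the drawing lies in a single component of `Jᶜ`, so any other component is a face.
  -- If there is no rest, any component will do.
  obtain ⟨z, hzJ, hdisj⟩ : ∃ z ∉ J, connectedComponentIn Jᶜ z ⊆ E.supportᶜ := by
    by_cases hne : ∃ n ∈ E.support, n ∉ J
    · obtain ⟨n, hn, hnJ⟩ := hne
      obtain ⟨z, hz, hzn⟩ := (harc n hnJ e₀ he₀).2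
      refine ⟨z, hz, fun y hy hys ↦ hzn ?_⟩
      rw [← (hzz y hys (connectedComponentIn_subset _ _ hy) n hn hnJ).connectedComponentIn_eq,
        ← connectedComponentIn_eq hy]
      exact mem_connectedComponentIn hz
    · push Not at hne
      exact ⟨z₀, hz₀, (connectedComponentIn_subset _ _).trans fun y hy hys ↦ hy (hne y hys)⟩
  have heq : connectedComponentIn E.supportᶜ z = connectedComponentIn Jᶜ z :=
    subset_antisymm (connectedComponentIn_mono z (compl_subset_compl.2 hJs))
      (isPreconnected_connectedComponentIn.subset_connectedComponentIn
        (mem_connectedComponentIn hzJ) hdisj)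
  refine ⟨z, hdisj (mem_connectedComponentIn hzJ), heq, fun e he ↦ ?_⟩
  rw [heq]
  exact (harc z hzJ e he).1

/-- Let a cycle, the union of `A₁` and `A₂`, bound a face, and let `K` be a connected subgraph that
contains the intersection of `A₁` and `A₂`. Then no node `x` can be joined both to a node of the
cycle outside of `K` and `A₂` and to one outside of `K` and `A₁`, by walks that avoid these
subgraphs. -/
theorem not_alternating [Finite V] {r : V} {c : G.Walk r r} {z : ℂ} (hz : z ∉ E.support)
    (heq : connectedComponentIn E.supportᶜ z = connectedComponentIn (E.drawing c.toSubgraph)ᶜ z)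
    (hfr : ∀ e ∈ c.edges, E.arc e ⊆ frontier (connectedComponentIn E.supportᶜ z))
    {K A₁ A₂ : G.Subgraph} (hA : c.toSubgraph ≤ A₁ ⊔ A₂) (hK : IsPreconnected (E.drawing K))
    (hA' : A₁ ⊓ A₂ ≤ K) {x b d : V} (hb : b ∈ c.support) (hd : d ∈ c.support)
    (pb : G.Walk b x) (hpb : ∀ w ∈ pb.support, w ∉ (K ⊔ A₂).verts)
    (pd : G.Walk d x) (hpd : ∀ w ∈ pd.support, w ∉ (K ⊔ A₁).verts) (hnil : ¬ c.Nil) : False := by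
  -- Inside the face one reaches its boundary node `b`, and from there the walk leads to `x`.
  have key : ∀ {b} {L : G.Subgraph}, b ∈ c.support → ∀ pb : G.Walk b x,
      (∀ w ∈ pb.support, w ∉ L.verts) → NotSeparated (E.drawing L) z (E.point x) := by
    intro b L hb pb hpb
    refine NotSeparated.trans (q := E.point b) ?_ (E.notSeparated_of_walk pb hpb)
    obtain ⟨e, he, hbe⟩ := (c.mem_support_iff_exists_mem_edges_of_not_nil hnil).1 hb
    have hbf : E.point b ∈ closure (connectedComponentIn E.supportᶜ z) :=
      frontier_subset_closure (hfr e he (E.point_mem_arc (c.edges_subset_edgeSet he) hbe))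
    refine ⟨insert (E.point b) (connectedComponentIn E.supportᶜ z),
      isPreconnected_connectedComponentIn.subset_closure (subset_insert _ _)
        (insert_subset hbf subset_closure), insert_subset ?_ ?_,
      Or.inr (mem_connectedComponentIn hz), Or.inl rfl⟩
    · exact fun h ↦ hpb b pb.start_mem_support (E.point_mem_drawing.1 h)
    · exact (connectedComponentIn_subset _ _).trans
        (compl_subset_compl.2 (E.drawing_subset_support L))
  -- The two obstacles intersect in `K ⊔ (A₁ ⊓ A₂) = K`, which is connected, so not even the whole
  -- cycle separates `z` from `x`. Thus the node `x` would lie in the face.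
  have h := NotSeparated.union (E.isCompact_drawing (K ⊔ A₂)) (E.isCompact_drawing (K ⊔ A₁)) (by
    rw [← drawing_inf, ← sup_inf_left, inf_comm, sup_eq_left.2 hA']
    exact hK) (key hb pb hpb) (key hd pd hpd)
  rw [← drawing_sup] at h
  have h' := h.mono (E.drawing_mono (hA.trans (by
    exact sup_le (le_sup_right.trans le_sup_right) (le_sup_right.trans le_sup_left))))
  have hx : E.point x ∈ connectedComponentIn E.supportᶜ z := by
    rw [heq, h'.connectedComponentIn_eq]
    exact mem_connectedComponentIn h'.right_notMem
  exact connectedComponentIn_subset _ _ hx (Or.inl ⟨x, rfl⟩)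

end PlanarEmbedding

/-! ### Boundary crossings of walks, and branches of trees -/

namespace SimpleGraph

variable {V : Type*} {G : SimpleGraph V}

/-- The edge `e` joins a node in `S` with a node outside of `S`. -/
def Crosses (S : Set V) (e : Sym2 V) : Prop := ∃ a b, e = s(a, b) ∧ a ∈ S ∧ b ∉ S

theorem crosses_mk {S : Set V} {a b : V} :
    Crosses S s(a, b) ↔ ¬ (a ∈ S ↔ b ∈ S) := by
  constructor
  · rintro ⟨a', b', h, ha, hb⟩
    rcases Sym2.eq_iff.1 h with ⟨rfl, rfl⟩ | ⟨rfl, rfl⟩ <;> tauto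
  · intro h
    by_cases ha : a ∈ S
    · exact ⟨a, b, rfl, ha, fun hb ↦ h (by tauto)⟩
    · exact ⟨b, a, Sym2.eq_swap, by tauto, ha⟩

namespace Walk

open scoped Classical in
/-- The number of times that a walk crosses the boundary of `S`. -/
noncomputable def crossings (S : Set V) {u v : V} (p : G.Walk u v) : ℕ :=
  (p.edges.filter (Crosses S ·)).length

theorem crossings_cons {S : Set V} {u v w : V} (h : G.Adj u v) (p : G.Walk v w) :
    (u ∈ S ↔ v ∈ S) ∧ (cons h p).crossings S = p.crossings S ∨
      ¬ (u ∈ S ↔ v ∈ S) ∧ (cons h p).crossings S = p.crossings S + 1 := by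
  classical
  by_cases hc : u ∈ S ↔ v ∈ S
  · left
    refine ⟨hc, ?_⟩
    rw [crossings, edges_cons, List.filter_cons_of_neg (by simpa [crosses_mk] using hc)]
    rfl
  · right
    refine ⟨hc, ?_⟩
    rw [crossings, edges_cons, List.filter_cons_of_pos (by simpa [crosses_mk] using hc)]
    rfl

theorem even_crossings_iff {S : Set V} {u v : V} (p : G.Walk u v) :
    Even (p.crossings S) ↔ (u ∈ S ↔ v ∈ S) := by
  induction p with
  | nil => simp [crossings]
  | cons h p ih =>
    rcases crossings_cons (S := S) h p with ⟨h1, h2⟩ | ⟨h1, h2⟩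
    · rw [h2, ih]; tauto
    · rw [h2, Nat.even_add_one, ih]; tauto

theorem mem_iff_of_crossings_eq_zero {S : Set V} {u v w : V} (p : G.Walk u v)
    (h0 : p.crossings S = 0) (hw : w ∈ p.support) : u ∈ S ↔ w ∈ S := by
  induction p with
  | nil => rw [support_nil, List.mem_singleton] at hw; rw [hw]
  | cons h p ih =>
    rcases crossings_cons (S := S) h p with ⟨h1, h2⟩ | ⟨h1, h2⟩
    · rw [support_cons, List.mem_cons] at hw
      rcases hw with rfl | hw
      · rfl
      · exact h1.trans (ih (h2 ▸ h0) hw)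
    · omega

theorem exists_notMem_of_crossings_ne_zero {S : Set V} {u v : V} (p : G.Walk u v)
    (h0 : p.crossings S ≠ 0) : ∃ w ∈ p.support, w ∉ S := by
  induction p with
  | nil => simp [crossings] at h0
  | @cons u v w h p ih =>
    by_cases hu : u ∈ S
    · by_cases hv : v ∈ S
      · rcases crossings_cons (S := S) h p with ⟨h1, h2⟩ | ⟨h1, h2⟩
        · obtain ⟨w, hw, hwS⟩ := ih (h2 ▸ h0)
          exact ⟨w, List.mem_cons_of_mem _ hw, hwS⟩
        · exact absurd (by tauto) h1
      · exact ⟨v, List.mem_cons_of_mem _ p.start_mem_support, hv⟩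
    · exact ⟨u, start_mem_support _, hu⟩

/-- Split where the walk first enters `S`; a further crossing remains, so it comes to a node outside
again. A walk that starts inside `S` needs one crossing more to leave first, hence the three in the
next lemma. -/
theorem exists_append_of_two_le_crossings {S : Set V} {u v : V} (p : G.Walk u v) (hu : u ∉ S)
    (h2 : 2 ≤ p.crossings S) : ∃ (w : V) (p₁ : G.Walk u w) (p₂ : G.Walk w v),
      p = p₁.append p₂ ∧ w ∈ S ∧ ∃ d ∈ p₂.support, d ∉ S := by
  induction p with
  | nil => simp [crossings] at h2
  | @cons u v w h p ih =>
    rcases crossings_cons (S := S) h p with ⟨h1, h3⟩ | ⟨h1, h3⟩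
    · obtain ⟨y, p₁, p₂, rfl, hy, hd⟩ := ih (by tauto) (h3 ▸ h2)
      exact ⟨y, cons h p₁, p₂, rfl, hy, hd⟩
    · exact ⟨v, cons h nil, p, rfl, by tauto,
        p.exists_notMem_of_crossings_ne_zero (S := S) (by omega)⟩

theorem exists_append_of_three_le_crossings {S : Set V} {u v : V} (p : G.Walk u v)
    (h3 : 3 ≤ p.crossings S) : ∃ (w : V) (p₁ : G.Walk u w) (p₂ : G.Walk w v),
      p = p₁.append p₂ ∧ w ∈ S ∧ (∃ b ∈ p₁.support, b ∉ S) ∧ ∃ d ∈ p₂.support, d ∉ S := by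
  induction p with
  | nil => simp [crossings] at h3
  | @cons u v w h p ih =>
    by_cases hu : u ∈ S
    · rcases crossings_cons (S := S) h p with ⟨h1, h4⟩ | ⟨h1, h4⟩
      · obtain ⟨y, p₁, p₂, rfl, hy, ⟨b, hb, hbS⟩, hd⟩ := ih (h4 ▸ h3)
        exact ⟨y, cons h p₁, p₂, rfl, hy, ⟨b, List.mem_cons_of_mem _ hb, hbS⟩, hd⟩
      · have hv : v ∉ S := by tauto
        obtain ⟨y, p₁, p₂, rfl, hy, hd⟩ :=
          p.exists_append_of_two_le_crossings (S := S) hv (by omega)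
        exact ⟨y, cons h p₁, p₂, rfl, hy,
          ⟨v, List.mem_cons_of_mem _ p₁.start_mem_support, hv⟩, hd⟩
    · obtain ⟨y, p₁, p₂, he, hy, hd⟩ :=
        (cons h p).exists_append_of_two_le_crossings hu (by omega)
      exact ⟨y, p₁, p₂, he, hy, ⟨u, p₁.start_mem_support, hu⟩, hd⟩

theorem crossings_rotate [DecidableEq V] {S : Set V} {u v : V} (c : G.Walk u u)
    (h : v ∈ c.support) : (c.rotate v h).crossings S = c.crossings S :=
  ((c.rotate_edges v h).perm.filter _).length_eq

/-- A node with only one neighbour lies on a path only as an end node. -/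
theorem IsPath.eq_or_eq_of_mem_support {u v w : V} {p : G.Walk u v} (hp : p.IsPath)
    (hw : w ∈ p.support) (huniq : ∀ a b, G.Adj w a → G.Adj w b → a = b) : w = u ∨ w = v := by
  induction p with
  | nil => exact Or.inl (by simpa using hw)
  | @cons u y v h p ih =>
    rw [cons_isPath_iff] at hp
    rw [support_cons, List.mem_cons] at hw
    rcases hw with rfl | hw
    · exact Or.inl rfl
    rcases ih hp.1 hw with rfl | rfl
    · cases p with
      | nil => exact Or.inr rfl
      | cons h' p =>
        have := huniq _ _ h.symm h'
        subst this
        exact absurd (by simp) hp.2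
    · exact Or.inr rfl

theorem IsPath.exists_tail {y x l l' : V} {q : G.Walk y x} (hq : q.IsPath) (hl : l ∈ q.support)
    (hl' : l' ∈ q.support) (hly : l ≠ y) (hly' : l' ≠ y) : ∃ (y' : V) (q' : G.Walk y' x),
      q'.IsPath ∧ l ∈ q'.support ∧ l' ∈ q'.support ∧ ∀ w ∈ q'.support, w ∈ q.support ∧ w ≠ y := by
  cases q with
  | nil => exact absurd (by simpa using hl) hly
  | cons h q =>
    rw [cons_isPath_iff] at hq
    rw [support_cons, List.mem_cons] at hl hl'
    refine ⟨_, q, hq.1, hl.resolve_left hly, hl'.resolve_left hly', fun w hw ↦ ⟨?_, ?_⟩⟩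
    · exact List.mem_cons_of_mem _ hw
    · rintro rfl; exact hq.2 hw

theorem IsPath.exists_walk_avoiding_ends {y x l l' : V} {q : G.Walk y x} (hq : q.IsPath)
    (hl : l ∈ q.support) (hl' : l' ∈ q.support) (hly : l ≠ y) (hly' : l' ≠ y) (hlx : l ≠ x)
    (hlx' : l' ≠ x) : ∃ p : G.Walk l l', ∀ w ∈ p.support, w ∈ q.support ∧ w ≠ y ∧ w ≠ x := by
  classical
  obtain ⟨y', q', hq', h1, h2, h3⟩ := hq.exists_tail hl hl' hly hly'
  obtain ⟨x', q'', -, h4, h5, h6⟩ := hq'.reverse.exists_tail (l := l) (l' := l')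
    (by simpa using h1) (by simpa using h2) hlx hlx'
  refine ⟨(q''.takeUntil l h4).reverse.append (q''.takeUntil l' h5), fun w hw ↦ ?_⟩
  have hw' : w ∈ q''.support := by
    rw [mem_support_append_iff, support_reverse, List.mem_reverse] at hw
    rcases hw with hw | hw
    · exact q''.support_takeUntil_subset_support h4 hw
    · exact q''.support_takeUntil_subset_support h5 hw
  have h7 := h6 w hw'
  rw [support_reverse, List.mem_reverse] at h7
  exact ⟨(h3 w h7.1).1, (h3 w h7.1).2, h7.2⟩

end Walk

/-- On a path of an acyclic graph, adjacent nodes are joined by an edge of the path. -/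
theorem IsAcyclic.mem_edges_of_adj (hG : G.IsAcyclic) {a b y z : V} (P : G.Walk a b)
    (hy : y ∈ P.support) (hz : z ∈ P.support) (h : G.Adj y z) : s(y, z) ∈ P.edges := by
  classical
  have h1 := isBridge_iff_forall_walk_mem_edges.1 (isAcyclic_iff_forall_adj_isBridge.1 hG h)
    ((P.takeUntil y hy).reverse.append (P.takeUntil z hz))
  rw [Walk.edges_append, Walk.edges_reverse, List.mem_append, List.mem_reverse] at h1
  rcases h1 with h1 | h1
  · exact P.edges_takeUntil_subset_edges hy h1
  · exact P.edges_takeUntil_subset_edges hz h1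

/-- The part of `G - x` that contains `w`. -/
def branch (G : SimpleGraph V) (x w : V) : Set V := {y | ∃ p : G.Walk w y, x ∉ p.support}

section branch

variable {x w : V}

theorem notMem_branch : x ∉ G.branch x w := fun ⟨p, hp⟩ ↦ hp p.end_mem_support

theorem mem_branch_self (h : G.Adj x w) : w ∈ G.branch x w :=
  ⟨Walk.nil, by simpa using h.ne⟩

theorem mem_branch_of_adj {y z : V} (hy : y ∈ G.branch x w) (h : G.Adj y z) (hz : z ≠ x) :
    z ∈ G.branch x w := by
  obtain ⟨p, hp⟩ := hy
  exact ⟨p.concat h, by rw [Walk.support_concat]; simp [hp, hz.symm]⟩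

/-- Otherwise `x` and `y` would be joined by two paths, the edge and one through `w`. -/
theorem IsAcyclic.eq_of_mem_branch (hG : G.IsAcyclic) (hw : G.Adj x w) {y : V}
    (hy : y ∈ G.branch x w) (h : G.Adj x y) : y = w := by
  classical
  obtain ⟨p, hp⟩ := hy
  have h1 : (Walk.cons hw p.bypass).IsPath :=
    p.bypass_isPath.cons fun hx ↦ hp (p.support_bypass_subset_support hx)
  have h2 : (Walk.cons h Walk.nil).IsPath := by simpa using h.ne
  have := congr_arg (fun q : G.Path x y ↦ q.1.snd) 
    ((hG.subsingleton_path x y).elim ⟨_, h1⟩ ⟨_, h2⟩)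
  simpa using this.symm

theorem IsAcyclic.eq_of_crosses_branch (hG : G.IsAcyclic) (hw : G.Adj x w) {e : Sym2 V}
    (he : e ∈ G.edgeSet) (h : Crosses (G.branch x w) e) : e = s(x, w) := by
  obtain ⟨y, z, rfl, hy, hz⟩ := h
  have hzx : z = x := by
    by_contra hne
    exact hz (mem_branch_of_adj hy he hne)
  subst hzx
  rw [hG.eq_of_mem_branch hw hy (Adj.symm he), Sym2.eq_swap]

theorem crosses_branch (hw : G.Adj x w) : Crosses (G.branch x w) s(x, w) :=
  ⟨w, x, Sym2.eq_swap, mem_branch_self hw, notMem_branch⟩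

theorem Walk.IsPath.exists_branch {y : V} {p : G.Walk x y} (hp : p.IsPath) (hy : y ≠ x) :
    ∃ w, G.Adj x w ∧ ∀ z ∈ p.support, z ≠ x → z ∈ G.branch x w := by
  classical
  cases p with
  | nil => exact absurd rfl hy
  | @cons _ w _ h p =>
    rw [cons_isPath_iff] at hp
    refine ⟨w, h, fun z hz hzx ↦ ?_⟩
    rw [support_cons, List.mem_cons] at hz
    have hz := hz.resolve_left hzx
    exact ⟨p.takeUntil z hz, fun hx ↦ hp.2 (p.support_takeUntil_subset_support hz hx)⟩

theorem IsAcyclic.branch_unique (hG : G.IsAcyclic) {w' y : V} (hw : G.Adj x w) (hw' : G.Adj x w')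
    (hy : y ∈ G.branch x w) (hy' : y ∈ G.branch x w') : w' = w := by
  obtain ⟨p, hp⟩ := hy
  obtain ⟨p', hp'⟩ := hy'
  refine hG.eq_of_mem_branch hw ⟨p.append p'.reverse, ?_⟩ hw'
  rw [Walk.mem_support_append_iff, Walk.support_reverse, List.mem_reverse]
  exact fun h ↦ h.elim hp hp'

theorem IsAcyclic.notMem_branch_of_mem_support (hG : G.IsAcyclic) (hw : G.Adj x w) {y z : V}
    {p : G.Walk x y} (hp : p.IsPath) (hy : y ∉ G.branch x w) (hz : z ∈ p.support) :
    z ∉ G.branch x w := by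
  intro hzw
  have hzx : z ≠ x := by rintro rfl; exact notMem_branch hzw
  have hyx : y ≠ x := by
    rintro rfl
    rw [Walk.nil_iff_support_eq.1 (Walk.isPath_iff_nil.1 hp)] at hz
    exact hzx (by simpa using hz)
  obtain ⟨w', hw', h⟩ := hp.exists_branch hyx
  have := hG.branch_unique hw hw' hzw (h z hz hzx)
  subst this
  exact hy (h y p.end_mem_support hyx)

end branch

/-- Outside of a path of a tree, every node can be joined to a leaf. -/
theorem IsTree.exists_walk_to_leaf [Fintype V] [DecidableRel G.Adj] (hG : G.IsTree) {a b : V}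
    {P : G.Walk a b} (hP : P.IsPath) {w : V} (hw : w ∉ P.support) :
    ∃ (l : V) (p : G.Walk w l), G.degree l = 1 ∧ ∀ y ∈ p.support, y ∉ P.support := by
  classical
  obtain ⟨q, hq, -⟩ := hG.existsUnique_path a w
  -- The path from `a` to `w` is prolonged until it ends in a leaf; its length is bounded by the
  -- number of nodes.
  induction hn : Fintype.card V - q.length using Nat.strong_induction_on generalizing w q with
  | _ n ih
  by_cases hd : G.degree w = 1
  · exact ⟨w, Walk.nil, hd, by simpa using hw⟩
  have hwa : w ≠ a := fun h ↦ hw (h ▸ P.start_mem_support)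
  have hqn : ¬ q.Nil := fun h ↦ hwa h.eq.symm
  have hadj : G.Adj w q.penultimate := (q.adj_penultimate hqn).symm
  obtain ⟨y, hy, hyp⟩ : ∃ y, G.Adj w y ∧ y ≠ q.penultimate := by
    by_contra! hall
    apply hd
    rw [← card_neighborFinset_eq_degree, Finset.card_eq_one]
    exact ⟨q.penultimate, by ext y; simpa using ⟨hall y, fun h ↦ h ▸ hadj⟩⟩
  have hyq : y ∉ q.support := fun h ↦
    hyp (hG.isAcyclic.eq_penultimate_of_adj_end hq hy h)
  have hq' : (q.concat hy).IsPath := hq.concat hyq hy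
  -- The unique path from `a` to `y` passes through `w`; if `y` were on `P`, it would be part of
  -- `P`.
  have hyP : y ∉ P.support := fun h ↦ by
    have := congr_arg (fun q : G.Path a y ↦ q.1.support)
      ((hG.isAcyclic.subsingleton_path a y).elim ⟨_, hq'⟩ ⟨_, hP.takeUntil h⟩)
    have hmem : w ∈ (q.concat hy).support := by simp [Walk.support_concat]
    simp only at this
    rw [this] at hmem
    exact hw (P.support_takeUntil_subset_support h hmem)
  have hlt := hq'.length_lt
  rw [Walk.length_concat] at hlt
  obtain ⟨l, p, hl, hp⟩ := ih (Fintype.card V - (q.concat hy).length)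
    (by rw [Walk.length_concat]; omega) hyP (q.concat hy) hq' rfl
  refine ⟨l, Walk.cons hy p, hl, fun z hz ↦ ?_⟩
  rw [Walk.support_cons, List.mem_cons] at hz
  rcases hz with rfl | hz
  · exact hw
  · exact hp z hz

end SimpleGraph

/-! ### Faces of a Halin graph -/

theorem PlanarEmbedding.ConsecutiveAt.symm {V : Type*} {G : SimpleGraph V} {E : PlanarEmbedding G}
    {u x v : V} (h : E.ConsecutiveAt u x v) : E.ConsecutiveAt v x u := by
  obtain ⟨F, hF, h1, h2⟩ := h
  exact ⟨F, hF, by rwa [Sym2.eq_swap], by rwa [Sym2.eq_swap]⟩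

namespace IsHalin

variable {V : Type*} [Fintype V] {T C : SimpleGraph V} [DecidableRel T.Adj]

theorem adj_unique {l a b : V} (hl : T.degree l = 1) (ha : T.Adj l a) (hb : T.Adj l b) : a = b := by
  obtain ⟨c, hc⟩ := Finset.card_eq_one.1 hl
  have h1 : a ∈ T.neighborFinset l := by simpa using ha
  have h2 : b ∈ T.neighborFinset l := by simpa using hb
  rw [hc, Finset.mem_singleton] at h1 h2
  rw [h1, h2]

theorem degree_eq_one_of_adj (hH : IsHalin T C) {a b : V} (h : C.Adj a b) : T.degree a = 1 := by
  obtain ⟨r, c, -, hs, he⟩ := hH.outer_cycle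
  exact (hs a).1 (c.fst_mem_support_of_mem_edges ((he s(a, b)).2 h))

/-- Two leaves are not adjacent in the tree. -/
theorem not_adj (hH : IsHalin T C) {a b : V} (ha : T.degree a = 1) (hb : T.degree b = 1) :
    ¬ T.Adj a b := by
  intro h
  -- A tree with two adjacent leaves has no other node, too few for the outer cycle.
  have hV : ∀ y, y = a ∨ y = b := by
    intro y
    by_cases hya : y = a
    · exact Or.inl hya
    obtain ⟨p, hp, -⟩ := hH.isTree.existsUnique_path a y
    cases p with
    | nil => exact Or.inl rfl
    | cons h' p =>
      have := adj_unique ha h h'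
      subst this
      rcases hp.eq_or_eq_of_mem_support (w := b) (by simp) (fun _ _ ↦ adj_unique hb) with h1 | h1
      · exact absurd h1 h.ne'
      · exact Or.inr h1.symm
  obtain ⟨r, c, hc, -, -⟩ := hH.outer_cycle
  have hlen := (hc.support_nodup.subperm (l₂ := [a, b]) fun y _ ↦ by simpa using hV y).length_le
  have := hc.three_le_length
  rw [List.length_tail, Walk.length_support] at hlen
  simp only [List.length_cons, List.length_nil] at hlen
  omega

/-- The outer cycle bounds a face. -/
theorem exists_outer_face (hH : IsHalin T C) (E : PlanarEmbedding (T ⊔ C)) :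
    ∃ (r : V) (c : (T ⊔ C).Walk r r), c.IsCycle ∧ (∀ v, v ∈ c.support ↔ T.degree v = 1) ∧
      (∀ e, e ∈ c.edges ↔ e ∈ C.edgeSet) ∧ ∃ z ∉ E.support,
      connectedComponentIn E.supportᶜ z = connectedComponentIn (E.drawing c.toSubgraph)ᶜ z ∧
      ∀ e ∈ c.edges, E.arc e ⊆ frontier (connectedComponentIn E.supportᶜ z) := by
  obtain ⟨r, c, hc, hs, he⟩ := hH.outer_cycle
  have hs' : ∀ v, v ∈ (c.mapLe (le_sup_right : C ≤ T ⊔ C)).support ↔ T.degree v = 1 := by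
    simpa using hs
  have he' : ∀ e, e ∈ (c.mapLe (le_sup_right : C ≤ T ⊔ C)).edges ↔ e ∈ C.edgeSet := by
    simpa using he
  have hc' : (c.mapLe (le_sup_right : C ≤ T ⊔ C)).IsCycle := hc.mapLe le_sup_right
  refine ⟨r, c.mapLe le_sup_right, hc', hs', he', E.exists_isFace_of_isCycle hc' ?_ ?_⟩
  · intro e heG hall
    induction e with | _ y z
    rw [he']
    rcases heG with h | h
    · exact absurd h (hH.not_adj ((hs' y).1 (hall y (by simp))) ((hs' z).1 (hall z (by simp))))
    · exact h
  · intro s t hs ht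
    obtain ⟨p, hp, -⟩ := hH.isTree.existsUnique_path s t
    refine ⟨p.mapLe le_sup_left, fun w hw hwc ↦ ?_⟩
    rw [Walk.support_mapLe_eq_support] at hw
    rcases hp.eq_or_eq_of_mem_support hw fun _ _ ↦ adj_unique ((hs' w).1 hwc) with rfl | rfl
    · exact hs hwc
    · exact ht hwc

/-- An edge `ab` of the outer cycle and the tree path from `a` to `b` lie on the boundary of a
common face. -/
theorem exists_face_of_adj (hH : IsHalin T C) (E : PlanarEmbedding (T ⊔ C)) {a b : V}
    (hab : C.Adj a b) {P : T.Walk a b} (hP : P.IsPath) :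
    ∃ F, E.IsFace F ∧ E.arc s(a, b) ⊆ frontier F ∧ ∀ e ∈ P.edges, E.arc e ⊆ frontier F := by
  have ha := hH.degree_eq_one_of_adj hab
  have hb := hH.degree_eq_one_of_adj hab.symm
  have hleaf : ∀ w ∈ P.support, T.degree w = 1 → w = a ∨ w = b := fun w hw hd ↦
    hP.eq_or_eq_of_mem_support hw fun _ _ ↦ adj_unique hd
  have hba : (T ⊔ C).Adj b a := Or.inr hab.symm
  have hc : (Walk.cons hba (P.mapLe (le_sup_left : T ≤ T ⊔ C))).IsCycle := by
    rw [Walk.cons_isCycle_iff]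
    refine ⟨hP.mapLe le_sup_left, fun h ↦ hH.not_adj hb ha ?_⟩
    rw [Walk.edges_mapLe_eq_edges] at h
    exact P.adj_of_mem_edges h
  have hs : ∀ w, w ∈ (Walk.cons hba (P.mapLe (le_sup_left : T ≤ T ⊔ C))).support ↔
      w ∈ P.support := fun w ↦ by
    rw [Walk.support_cons, Walk.support_mapLe_eq_support, List.mem_cons]
    exact ⟨fun h ↦ h.elim (fun h ↦ h ▸ P.end_mem_support) id, Or.inr⟩
  have he : ∀ e, e ∈ (Walk.cons hba (P.mapLe (le_sup_left : T ≤ T ⊔ C))).edges ↔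
      e = s(a, b) ∨ e ∈ P.edges := fun e ↦ by
    rw [Walk.edges_cons, Walk.edges_mapLe_eq_edges, List.mem_cons, Sym2.eq_swap]
  obtain ⟨z, hz, -, hfr⟩ := E.exists_isFace_of_isCycle hc (fun e heG hall ↦ by
    induction e with | _ y z
    have hy := (hs y).1 (hall y (by simp))
    have hz := (hs z).1 (hall z (by simp))
    rw [he]
    rcases heG with h | h
    · exact Or.inr (hH.isTree.isAcyclic.mem_edges_of_adj P hy hz h)
    · left
      rcases hleaf y hy (hH.degree_eq_one_of_adj h) with rfl | rfl <;>
      rcases hleaf z hz (hH.degree_eq_one_of_adj h.symm) with rfl | rfl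
      · exact absurd rfl h.ne
      · rfl
      · exact Sym2.eq_swap
      · exact absurd rfl h.ne) (fun s t hs' ht' ↦ by
    rw [hs] at hs' ht'
    -- Off `P`, each of the two nodes reaches a leaf other than `a` and `b`. These leaves are joined
    -- along the outer cycle without its edge `ab`, on which only `a` and `b` belong to `P`.
    obtain ⟨l, p, hl, hp⟩ := hH.isTree.exists_walk_to_leaf hP hs'
    obtain ⟨l', p', hl', hp'⟩ := hH.isTree.exists_walk_to_leaf hP ht'
    obtain ⟨r, c, hc, hcs, hce⟩ := hH.outer_cycle
    obtain ⟨x, y, h, q, hxy, hq, -, hqs, -⟩ := hc.exists_adj_path ((hce s(a, b)).2 hab)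
    have hne : ∀ {m}, m ∉ P.support → m ≠ a ∧ m ≠ b := fun hm ↦
      ⟨fun h ↦ hm (h ▸ P.start_mem_support), fun h ↦ hm (h ▸ P.end_mem_support)⟩
    have hxy' : ∀ m, m ≠ y ∧ m ≠ x ↔ m ≠ a ∧ m ≠ b := fun m ↦ by
      rcases Sym2.eq_iff.1 hxy with ⟨rfl, rfl⟩ | ⟨rfl, rfl⟩ <;> tauto
    have h1 := (hxy' l).2 (hne (hp l p.end_mem_support))
    have h2 := (hxy' l').2 (hne (hp' l' p'.end_mem_support))
    obtain ⟨p'', hp''⟩ := hq.exists_walk_avoiding_ends ((hqs l).1 ((hcs l).2 hl))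
      ((hqs l').1 ((hcs l').2 hl')) h1.1 h2.1 h1.2 h2.2
    refine ⟨((p.mapLe le_sup_left).append (p''.mapLe le_sup_right)).append
      (p'.mapLe le_sup_left).reverse, fun w hw hwP ↦ ?_⟩
    rw [hs] at hwP
    rw [Walk.mem_support_append_iff, Walk.mem_support_append_iff, Walk.support_reverse,
      List.mem_reverse, Walk.support_mapLe_eq_support, Walk.support_mapLe_eq_support,
      Walk.support_mapLe_eq_support] at hw
    rcases hw with (hw | hw) | hw
    · exact hp w hw hwP
    · obtain ⟨hwq, hwxy⟩ := hp'' w hw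
      have := (hxy' w).1 hwxy
      have := hleaf w hwP ((hcs w).1 ((hqs w).2 hwq))
      tauto
    · exact hp' w hw hwP)
  refine ⟨_, ⟨z, hz, rfl⟩, hfr _ ((he _).2 (Or.inl rfl)), fun e heP ↦ hfr e ((he e).2 (Or.inr heP))⟩

/-- The outer cycle crosses the boundary of a branch of the tree at most twice. -/
theorem crossings_branch_le_two (hH : IsHalin T C) (E : PlanarEmbedding (T ⊔ C)) {r : V}
    {c : (T ⊔ C).Walk r r} (hc : c.IsCycle) (hs : ∀ v, v ∈ c.support ↔ T.degree v = 1) {z : ℂ}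
    (hz : z ∉ E.support)
    (heq : connectedComponentIn E.supportᶜ z = connectedComponentIn (E.drawing c.toSubgraph)ᶜ z)
    (hfr : ∀ e ∈ c.edges, E.arc e ⊆ frontier (connectedComponentIn E.supportᶜ z))
    {x w : V} (hx : T.degree x ≠ 1) (hxw : T.Adj x w) : c.crossings (T.branch x w) ≤ 2 := by
  classical
  by_contra! h3
  set B := T.branch x w with hB
  have hac := hH.isTree.isAcyclic
  -- Rotating the cycle to a base point in `B` and splitting it at a second visit `m` to `B` gives
  -- two arcs that meet only in nodes of `B`, each with a node outside `B`.
  obtain ⟨m₀, p₀, q₀, hpq₀, hm₀, -⟩ := c.exists_append_of_three_le_crossings h3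
  have hm₀c : m₀ ∈ c.support := by
    rw [hpq₀, Walk.mem_support_append_iff]; exact Or.inl p₀.end_mem_support
  have h3' : 3 ≤ (c.rotate m₀ hm₀c).crossings B := by rw [Walk.crossings_rotate]; exact h3
  obtain ⟨m, p, q, hpq, hm, ⟨b, hbp, hbB⟩, d, hdq, hdB⟩ :=
    (c.rotate m₀ hm₀c).exists_append_of_three_le_crossings h3'
  have hsub : c.toSubgraph = p.toSubgraph ⊔ q.toSubgraph := by
    rw [← c.toSubgraph_rotate hm₀c, hpq, Walk.toSubgraph_append]
  have hsup : ∀ y, y ∈ c.support ↔ y ∈ p.support ∨ y ∈ q.support := fun y ↦ by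
    rw [← c.mem_verts_toSubgraph, hsub, Subgraph.verts_sup, Set.mem_union,
      Walk.mem_verts_toSubgraph, Walk.mem_verts_toSubgraph]
  have hpqB : ∀ y, y ∈ p.support → y ∈ q.support → y ∈ B := by
    intro y hyp hyq
    by_contra hyB
    have hnd := (hc.rotate hm₀c).support_nodup
    rw [hpq, Walk.tail_support_append, List.nodup_append] at hnd
    rw [← Walk.cons_tail_support, List.mem_cons] at hyp hyq
    exact hnd.2.2 y (hyp.resolve_left fun h ↦ hyB (h ▸ hm₀)) y
      (hyq.resolve_left fun h ↦ hyB (h ▸ hm)) rfl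
  have hxc : ¬ x ∈ c.support := fun h ↦ hx ((hs x).1 h)
  -- The tree path from the leaf `y` to `x` stays outside `B`, and its nodes other than `y` are not
  -- leaves, so it meets the outer cycle in `y` only.
  have hwalk : ∀ y (L : (T ⊔ C).Subgraph), y ∉ B → y ∈ c.support →
      (∀ v ∈ L.verts, v ∈ c.support) → y ∉ L.verts →
      ∃ p : (T ⊔ C).Walk y x, ∀ v ∈ p.support, v ∉ ((⊤ : (T ⊔ C).Subgraph).induce B ⊔ L).verts := by
    intro y L hyB hyc hL hyL
    obtain ⟨p, hp, -⟩ := hH.isTree.existsUnique_path x y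
    refine ⟨p.reverse.mapLe le_sup_left, fun v hv ↦ ?_⟩
    rw [Walk.support_mapLe_eq_support, Walk.support_reverse, List.mem_reverse] at hv
    rintro (hvB | hvL)
    · exact hac.notMem_branch_of_mem_support hxw hp hyB hv hvB
    · have hvc := hL v hvL
      rcases hp.eq_or_eq_of_mem_support hv fun _ _ ↦ adj_unique ((hs v).1 hvc) with rfl | rfl
      · exact hxc hvc
      · exact hyL hvL
  have hbc : b ∈ c.support := (hsup b).2 (Or.inl hbp)
  have hdc : d ∈ c.support := (hsup d).2 (Or.inr hdq)
  obtain ⟨pb, hpb⟩ := hwalk b q.toSubgraph hbB hbc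
    (fun v hv ↦ (hsup v).2 (Or.inr (q.mem_verts_toSubgraph.1 hv)))
    (fun h ↦ hbB (hpqB b hbp (q.mem_verts_toSubgraph.1 h)))
  obtain ⟨pd, hpd⟩ := hwalk d p.toSubgraph hdB hdc
    (fun v hv ↦ (hsup v).2 (Or.inl (p.mem_verts_toSubgraph.1 hv)))
    (fun h ↦ hdB (hpqB d (p.mem_verts_toSubgraph.1 h) hdq))
  refine E.not_alternating hz heq hfr hsub.le ?_ ?_ hbc hdc pb hpb pd hpd hc.not_nil
  · refine E.isPreconnected_drawing_of_forall w fun y hy ↦ ?_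
    obtain ⟨p, hp⟩ := hy
    have hpB : ∀ v ∈ p.support, v ∈ B := fun v hv ↦
      ⟨p.takeUntil v hv, fun h ↦ hp (p.support_takeUntil_subset_support hv h)⟩
    refine ⟨p.mapLe le_sup_left, ?_, ?_⟩
    · intro v hv
      rw [Walk.mem_verts_toSubgraph, Walk.support_mapLe_eq_support] at hv
      exact hpB v hv
    · intro v v' hv
      have h1 := Subgraph.edge_vert _ hv
      have h2 := Subgraph.edge_vert _ hv.symm
      rw [Walk.mem_verts_toSubgraph, Walk.support_mapLe_eq_support] at h1 h2
      exact ⟨hpB v h1, hpB v' h2, Subgraph.adj_sub _ hv⟩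
  · have hv : ∀ v ∈ (p.toSubgraph ⊓ q.toSubgraph).verts, v ∈ B := fun v hv ↦
      hpqB v (p.mem_verts_toSubgraph.1 hv.1) (q.mem_verts_toSubgraph.1 hv.2)
    exact ⟨hv, fun v v' h ↦ ⟨hv v (Subgraph.edge_vert _ h), hv v' (Subgraph.edge_vert _ h.symm),
      Subgraph.adj_sub _ h⟩⟩

end IsHalin

/-! ### Hamilton cycles -/

theorem SimpleGraph.Walk.IsCycle.eq_or_eq_of_mem_edges {V : Type*} [Finite V] {G : SimpleGraph V}
    {r x u v w : V} {τ : G.Walk r r} (hτ : τ.IsCycle) (huv : u ≠ v) (hu : s(x, u) ∈ τ.edges)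
    (hv : s(x, v) ∈ τ.edges) (hw : s(x, w) ∈ τ.edges) : w = u ∨ w = v := by
  by_contra! h
  have h2 := hτ.ncard_neighborSet_toSubgraph_eq_two (τ.fst_mem_support_of_mem_edges hu)
  have hsub : ({u, v, w} : Set V) ⊆ τ.toSubgraph.neighborSet x := by
    rintro y (rfl | rfl | rfl) <;>
    exact Walk.adj_toSubgraph_iff_mem_edges.2 ‹_›
  have h3 := Set.ncard_le_ncard hsub (Set.toFinite _)
  rw [Set.ncard_eq_three.2 ⟨u, v, w, huv, h.1.symm, h.2.symm, rfl⟩] at h3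
  omega

namespace IsHalin

variable {V : Type*} [Fintype V] {T C : SimpleGraph V} [DecidableRel T.Adj]

/-- Tree edges that a Hamilton cycle uses at an inner node lie in branches joined by an edge of
the outer cycle. -/
theorem exists_adj_branch [DecidableEq V] (hH : IsHalin T C) (E : PlanarEmbedding (T ⊔ C))
    {r : V} {τ : (T ⊔ C).Walk r r} (hτ : τ.IsHamiltonianCycle) {u x v : V} (huv : u ≠ v)
    (hx : T.degree x ≠ 1) (hu : s(x, u) ∈ τ.edges) (hv : s(x, v) ∈ τ.edges) (hxu : T.Adj x u) :
    ∃ l m, C.Adj l m ∧ l ∈ T.branch x u ∧ m ∈ T.branch x v := by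
  classical
  obtain ⟨r', c, hc, hs, he, z, hz, heq, hfr⟩ := hH.exists_outer_face E
  have hac := hH.isTree.isAcyclic
  have hCx : ∀ y, s(x, y) ∉ C.edgeSet := fun y h ↦ hx (hH.degree_eq_one_of_adj h)
  have hcross : ∀ {w}, T.Adj x w → ∀ e ∈ τ.edges, Crosses (T.branch x w) e →
      e = s(x, w) ∨ e ∈ c.edges := by
    intro w hw e heτ hcr
    rw [he]
    have := τ.edges_subset_edgeSet heτ
    rw [edgeSet_sup] at this
    rcases this with h | h
    · exact Or.inl (hac.eq_of_crosses_branch hw h hcr)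
    · exact Or.inr h
  have heven : ∀ {w s : V} (p : (T ⊔ C).Walk s s), Even (p.crossings (T.branch x w)) := fun p ↦
    p.even_crossings_iff.2 Iff.rfl
  -- If `τ` used every outer edge that crosses the branch of `u`, it would cross exactly once more
  -- than the outer cycle, by `xu`. Both numbers are even.
  obtain ⟨e, hec, hcr, heτ⟩ : ∃ e ∈ c.edges, Crosses (T.branch x u) e ∧ e ∉ τ.edges := by
    by_contra! hall
    have hperm : (τ.edges.filter (Crosses (T.branch x u) ·)).Perm
        (s(x, u) :: c.edges.filter (Crosses (T.branch x u) ·)) := by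
      rw [List.perm_ext_iff_of_nodup (hτ.isCycle.edges_nodup.filter _)
        (List.nodup_cons.2 ⟨fun h ↦ hCx u ((he _).1 (List.mem_of_mem_filter h)),
          hc.edges_nodup.filter _⟩)]
      intro e
      rw [List.mem_cons, List.mem_filter, List.mem_filter, decide_eq_true_iff]
      constructor
      · rintro ⟨h1, h2⟩
        exact (hcross hxu e h1 h2).imp id fun h ↦ ⟨h, h2⟩
      · rintro (rfl | ⟨h1, h2⟩)
        · exact ⟨hu, crosses_branch hxu⟩
        · exact ⟨hall e h1 h2, h2⟩
    have h1 := hperm.length_eq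
    rw [List.length_cons] at h1
    have h2 := heven (w := u) τ
    rw [Walk.crossings, h1, Nat.even_add_one] at h2
    exact h2 (heven c)
  obtain ⟨l, m, rfl, hl, hm⟩ := hcr
  have hlm : C.Adj l m := (he _).1 hec
  have hmx : m ≠ x := fun h ↦ hCx l ((mem_edgeSet C).2 (h ▸ hlm.symm))
  obtain ⟨p, hp, -⟩ := hH.isTree.existsUnique_path x m
  obtain ⟨w, hw, hwb⟩ := hp.exists_branch hmx
  have hmw := hwb m p.end_mem_support hmx
  refine ⟨l, m, hlm, hl, ?_⟩
  by_contra hmv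
  have hwu : w ≠ u := by rintro rfl; exact hm hmw
  have hwv : w ≠ v := by rintro rfl; exact hmv hmw
  have hxw : s(x, w) ∉ τ.edges := fun h ↦
    (hτ.isCycle.eq_or_eq_of_mem_edges huv hu hv h).elim hwu hwv
  have hlw : l ∉ T.branch x w := fun h ↦ hwu (hac.branch_unique hxu hw hl h)
  have h2 := hH.crossings_branch_le_two E hc hs hz heq hfr hx hw
  -- As `xw` is not in `τ`, all crossings of `τ` are outer edges, and `lm` is a crossing that `τ`
  -- lacks.
  have hlt : τ.crossings (T.branch x w) + 1 ≤ c.crossings (T.branch x w) := by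
    rw [Walk.crossings, Walk.crossings, ← List.length_cons (a := s(l, m))]
    refine (List.Nodup.subperm (List.nodup_cons.2
      ⟨fun h ↦ heτ (List.mem_of_mem_filter h), hτ.isCycle.edges_nodup.filter _⟩) ?_).length_le
    intro e h
    rw [List.mem_cons, List.mem_filter, decide_eq_true_iff] at h
    rw [List.mem_filter, decide_eq_true_iff]
    rcases h with rfl | ⟨h1, h2⟩
    · exact ⟨hec, m, l, Sym2.eq_swap, hmw, hlw⟩
    · refine ⟨(hcross hw e h1 h2).resolve_left ?_, h2⟩
      rintro rfl
      exact hxw h1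
  have h0 : τ.crossings (T.branch x w) = 0 := by
    have := heven (w := w) τ
    rw [Nat.even_iff] at this
    omega
  have h3 := τ.mem_iff_of_crossings_eq_zero h0 (hτ.mem_support x)
  have h4 := τ.mem_iff_of_crossings_eq_zero h0 (hτ.mem_support w)
  exact notMem_branch (h3.1 (h4.2 (mem_branch_self hw)))

/-- The only tree edge that leaves the branch is `xu`. -/
theorem mem_edges_of_mem_branch (hH : IsHalin T C) {x u l m : V} (hxu : T.Adj x u)
    (hl : l ∈ T.branch x u) (hm : m ∉ T.branch x u) (P : T.Walk l m) : s(x, u) ∈ P.edges := by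
  obtain ⟨d, hd, h1, h2⟩ := P.exists_boundary_dart _ hl hm
  have := hH.isTree.isAcyclic.eq_of_crosses_branch hxu d.edge_mem ⟨_, _, rfl, h1, h2⟩
  rw [← this]
  exact List.mem_map_of_mem hd

/-- The tree edge at the leaf is the first edge of the tree path from `x` to `v`, which shares a
face with the outer edge `xv`. -/
theorem consecutiveAt_leaf (hH : IsHalin T C) (E : PlanarEmbedding (T ⊔ C)) {u x v : V}
    (hx : T.degree x = 1) (hxu : T.Adj x u) (hxv : C.Adj x v) : E.ConsecutiveAt u x v := by
  obtain ⟨P, hP, -⟩ := hH.isTree.existsUnique_path x v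
  obtain ⟨F, hF, h1, h2⟩ := hH.exists_face_of_adj E hxv hP
  refine ⟨F, hF, ?_, h1⟩
  rw [Sym2.eq_swap]
  apply h2
  cases P with
  | nil => exact absurd rfl hxv.ne
  | cons h P =>
    rw [adj_unique hx hxu h]
    simp

end IsHalin

theorem mainTheorem5 {V : Type*} [Fintype V] [DecidableEq V] (T C : SimpleGraph V)
    [DecidableRel T.Adj] (hH : IsHalin T C) (E : PlanarEmbedding (T ⊔ C))
    (r : V) (τ : (T ⊔ C).Walk r r) (hτ : τ.IsHamiltonianCycle) :
    ¬ ∃ u x v : V, u ≠ v ∧ s(u, x) ∈ τ.edges ∧ s(x, v) ∈ τ.edges ∧ ¬ E.ConsecutiveAt u x v := by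
  rintro ⟨u, x, v, huv, hu, hv, hcons⟩
  apply hcons
  rw [Sym2.eq_swap] at hu
  have hxu : (T ⊔ C).Adj x u := τ.adj_of_mem_edges hu
  have hxv : (T ⊔ C).Adj x v := τ.adj_of_mem_edges hv
  by_cases hx : T.degree x = 1
  -- A leaf has one tree edge, so two tree edges are excluded; two outer edges share the outer face.
  · rcases hxu with hxu | hxu <;> rcases hxv with hxv | hxv
    · exact absurd (IsHalin.adj_unique hx hxu hxv) huv
    · exact hH.consecutiveAt_leaf E hx hxu hxv
    · exact (hH.consecutiveAt_leaf E hx hxv hxu).symm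
    · obtain ⟨r', c, -, -, he, z, hz, -, hfr⟩ := hH.exists_outer_face E
      exact ⟨_, ⟨z, hz, rfl⟩, hfr _ ((he _).2 hxu.symm), hfr _ ((he _).2 hxv)⟩
  · have hTu : T.Adj x u := hxu.resolve_right fun h ↦ hx (hH.degree_eq_one_of_adj h)
    have hTv : T.Adj x v := hxv.resolve_right fun h ↦ hx (hH.degree_eq_one_of_adj h)
    obtain ⟨l, m, hlm, hl, hm⟩ := hH.exists_adj_branch E hτ huv hx hu hv hTu
    have hac := hH.isTree.isAcyclic
    obtain ⟨P, hP, -⟩ := hH.isTree.existsUnique_path l m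
    obtain ⟨F, hF, -, h2⟩ := hH.exists_face_of_adj E hlm hP
    refine ⟨F, hF, ?_, ?_⟩
    · rw [Sym2.eq_swap]
      exact h2 _ (hH.mem_edges_of_mem_branch hTu hl
        (fun h ↦ huv (hac.branch_unique hTv hTu hm h)) P)
    · have := hH.mem_edges_of_mem_branch hTv hm
        (fun h ↦ huv (hac.branch_unique hTv hTu h hl)) P.reverse
      rw [Walk.edges_reverse, List.mem_reverse] at this
      exact h2 _ this
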